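/- All graphs are finite and simple. For a graph $G=(V,E)$ and $U,W\subseteq V$ let $e(U,W)$ be the number of edges $uw\in E$ with $u\in U$, $w\in W$ (edges with both ends in $U\cap W$ being counted twice). A family $\mathcal F$ of graphs is called nice if it is closed under taking minors and there is a constant $\beta_{\mathcal F}$ such that for every $G\in\mathcal F$ and every $B\subseteq V(G)$, the set $A$ of vertices in $V(G)\setminus B$ with at least three neighbours in $B$ satisfies $e(A,B)\le\beta_{\mathcal F}\,|B|$. Let $G$ be a planar graph, let $B$ be a non-empty set of vertices of $G$, and let $A$ be the set of vertices in $V(G)\setminus B$ that have at least three neighbours in $B$. Then $e(A,B)<6\,|B|$. Moreover, the family of planar graphs is nice. -/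

import Mathlib

universe u v

/-- The Euclidean plane. -/
abbrev Plane : Type := EuclideanSpace ℝ (Fin 2)

/-- `S` is a (simple) polygonal arc in the plane with end points `x` and `y`: it is the union of
finitely many non-degenerate straight line segments `[p 0, p 1], …, [p (n-1), p n]` with `n ≥ 1`,
`p 0 = x` and `p n = y`, where consecutive segments meet only in their common end point, and
non-consecutive segments are disjoint. -/
def IsPolygonalArc (x y : Plane) (S : Set Plane) : Prop :=
  ∃ (n : ℕ) (p : ℕ → Plane), 0 < n ∧ p 0 = x ∧ p n = y ∧
    (∀ i, i < n → p i ≠ p (i + 1)) ∧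
    (∀ i, i + 1 < n →
      segment ℝ (p i) (p (i + 1)) ∩ segment ℝ (p (i + 1)) (p (i + 2)) = {p (i + 1)}) ∧
    (∀ i j, i + 1 < j → j < n →
      Disjoint (segment ℝ (p i) (p (i + 1))) (segment ℝ (p j) (p (j + 1)))) ∧
    S = ⋃ i ∈ Set.Iio n, segment ℝ (p i) (p (i + 1))

namespace SimpleGraph

/-- A drawing of `G` in the plane without crossings: the vertices are distinct points, each edge is
a polygonal arc between its end vertices, an edge passes through no vertex other than its ends, and
two different edges have no point in common except a common end vertex. The value of `curve` off the
edge set is irrelevant. -/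
structure PlaneDrawing {V : Type u} (G : SimpleGraph V) where
  /-- the points that represent the vertices -/
  pos : V → Plane
  /-- the arcs that represent the edges -/
  curve : Sym2 V → Set Plane
  pos_injective : Function.Injective pos
  isPolygonalArc : ∀ a b, G.Adj a b → IsPolygonalArc (pos a) (pos b) (curve s(a, b))
  mem_of_pos_mem : ∀ e ∈ G.edgeSet, ∀ w, pos w ∈ curve e → w ∈ e
  eq_pos_of_mem : ∀ e ∈ G.edgeSet, ∀ f ∈ G.edgeSet, e ≠ f →
    ∀ z ∈ curve e ∩ curve f, ∃ w, w ∈ e ∧ w ∈ f ∧ z = pos w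

/-- A graph is planar if it can be drawn in the plane without crossings. -/
def IsPlanar {V : Type u} (G : SimpleGraph V) : Prop :=
  Nonempty G.PlaneDrawing

/-- `H` is a minor of `G`: there are pairwise disjoint branch sets in `G`, one for each vertex of
`H`, each of them inducing a connected (in particular non-empty) subgraph, such that adjacent
vertices of `H` have branch sets that are joined by an edge of `G`. -/
def IsMinorOf {W : Type v} {V : Type u} (H : SimpleGraph W) (G : SimpleGraph V) : Prop :=
  ∃ branch : W → Set V,
    (∀ w, (G.induce (branch w)).Connected) ∧
    (∀ w w', w ≠ w' → Disjoint (branch w) (branch w')) ∧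
    (∀ w w', H.Adj w w' → ∃ a ∈ branch w, ∃ b ∈ branch w', G.Adj a b)

/-- `e(U, W)`: the number of edges `uw` with `u ∈ U` and `w ∈ W`, where an edge with both ends in
`U ∩ W` is counted twice. -/
noncomputable def edgesBetween {V : Type u} (G : SimpleGraph V) (U W : Set V) : ℕ :=
  {p : V × V | p.1 ∈ U ∧ p.2 ∈ W ∧ G.Adj p.1 p.2}.ncard

/-- The set of vertices outside `B` that have at least three neighbours in `B`. -/
def threeAttached {V : Type u} (G : SimpleGraph V) (B : Set V) : Set V :=
  {a | a ∉ B ∧ 3 ≤ (G.neighborSet a ∩ B).ncard}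

/-- A family of finite graphs is nice if it is closed under taking minors and there is a constant
`β` such that `e(A, B) ≤ β |B|` for every graph of the family and every set `B` of its vertices,
where `A` is the set of vertices outside `B` with at least three neighbours in `B`. -/
def IsNiceFamily (F : ∀ V : Type u, SimpleGraph V → Prop) : Prop :=
  (∀ (V W : Type u) [Finite V] [Finite W] (G : SimpleGraph V) (H : SimpleGraph W),
    F V G → H.IsMinorOf G → F W H) ∧
  ∃ β : ℝ, ∀ (V : Type u) [Finite V] (G : SimpleGraph V), F V G →
    ∀ B : Set V, (G.edgesBetween (G.threeAttached B) B : ℝ) ≤ β * (B.ncard : ℝ)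

end SimpleGraph

/-!
**The bound.** The edges between `A` and `B` form a bipartite plane graph, and it suffices that such
a graph with `n` vertices has fewer than `2 * n` edges: as each vertex of `A` has at least three
neighbours in `B`, the number `e` of edges satisfies `3 * |A| ≤ e`, and `e < 2 * (|A| + |B|)` then
gives `e < 6 * |B|`.

For the bound on the edges of a bipartite plane graph, the arcs are cut into straight segments
(`SegSystem`). A cycle modulo 2 of this system assigns to each point off the segments the parity of
the number of its segments that a vertical ray from the point crosses. This parity is locally
constant, and it jumps exactly across the segments of the cycle (`SegSystem.label_sides`). The
points off the segments are divided into faces according to their parities for all cycles. As the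
faces tell the cycles apart, and inner corners of arcs add as many segments as points, there are at
least `e - n + 1` faces (`SegSystem.card_add_one_le`).
If there are two faces or more, then each has a non-empty boundary, because the plane is connected
(`SegSystem.exists_jumps`), and the boundary has no loose ends, because a disc without a radius is
connected (`SegSystem.exists_jumps_ne`). In a bipartite graph such a boundary has at least four
edges, while an edge lies on the boundary of at most two faces. Hence four times the number of faces
is at most `2 * e`, which together with the lower bound gives `e ≤ 2 * n - 2`; if there is only one
face, the lower bound gives `e ≤ n` (`SimpleGraph.PlaneDrawing.card_edges_bipartite`).

**Minors.** It suffices to contract one edge `uv` of a plane graph at a time. The arcs at `v` are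
pulled back along the arc of `uv`, over one straight segment `cx` after the other, from `x` to `c`
(`exists_reroute_path`). For one segment, take an ellipse with foci `c` and `x` that is so thin that
it meets only the segments that start at `c` or `x`, and replace the part of each arc inside the
ellipse by the straight segment from `c` to the point where the arc leaves the ellipse. Since the
ellipse is convex and different arcs leave it at different points, the new segments meet each other,
and the segments that start at `c`, only in `c` (`exists_reroute_segment`).
-/

open Set Filter Topology

/-! ### Segments and lines in coordinates -/

namespace Plane

/-- Twice the signed area of the triangle `a b z`: positive when `z` is to the left of the line
from `a` to `b`. -/
def orient (a b z : Plane) : ℝ := (b 0 - a 0) * (z 1 - a 1) - (b 1 - a 1) * (z 0 - a 0)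

lemma continuous_coord (i : Fin 2) : Continuous fun z : Plane => z i := by fun_prop

lemma continuous_orient (a b : Plane) : Continuous (orient a b) := by
  unfold orient; fun_prop

lemma orient_swap (a b z : Plane) : orient b a z = -orient a b z := by
  unfold orient; ring

lemma ext_coord {z w : Plane} (h0 : z 0 = w 0) (h1 : z 1 = w 1) : z = w := by
  ext i; fin_cases i <;> assumption

lemma lineMap_coord (a b : Plane) (t : ℝ) (i : Fin 2) :
    AffineMap.lineMap a b t i = a i + t * (b i - a i) := by
  simp [AffineMap.lineMap_apply]; ring

lemma orient_lineMap (a b : Plane) (t : ℝ) : orient a b (AffineMap.lineMap a b t) = 0 := by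
  simp only [orient, lineMap_coord]; ring

lemma mem_segment_iff {a b z : Plane} :
    z ∈ segment ℝ a b ↔ ∃ t : ℝ, 0 ≤ t ∧ t ≤ 1 ∧ AffineMap.lineMap a b t = z := by
  rw [segment_eq_image_lineMap]
  simp [and_assoc]

lemma mem_openSegment_iff {a b z : Plane} :
    z ∈ openSegment ℝ a b ↔ ∃ t : ℝ, 0 < t ∧ t < 1 ∧ AffineMap.lineMap a b t = z := by
  rw [openSegment_eq_image_lineMap]
  simp [and_assoc]

lemma orient_eq_zero_of_mem {a b z : Plane} (h : z ∈ segment ℝ a b) : orient a b z = 0 := by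
  obtain ⟨t, -, -, rfl⟩ := mem_segment_iff.1 h
  exact orient_lineMap a b t

/-- The squared length of `b - a`. -/
def sqLen (a b : Plane) : ℝ := (b 0 - a 0) ^ 2 + (b 1 - a 1) ^ 2

lemma sqLen_pos {a b : Plane} (h : a ≠ b) : 0 < sqLen a b := by
  unfold sqLen
  by_contra hn
  apply h
  have h0 := sq_nonneg (b 0 - a 0)
  have h1 := sq_nonneg (b 1 - a 1)
  apply ext_coord
  · have : (b 0 - a 0) ^ 2 = 0 := by linarith
    have := pow_eq_zero_iff (two_ne_zero) |>.1 this
    linarith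
  · have : (b 1 - a 1) ^ 2 = 0 := by linarith
    have := pow_eq_zero_iff (two_ne_zero) |>.1 this
    linarith

/-- The position, as a multiple of `b - a`, of the projection of `z` to the line `ab`. -/
noncomputable def lineParam (a b z : Plane) : ℝ :=
  ((b 0 - a 0) * (z 0 - a 0) + (b 1 - a 1) * (z 1 - a 1)) / sqLen a b

lemma continuous_lineParam (a b : Plane) : Continuous (lineParam a b) := by
  unfold lineParam; fun_prop

lemma lineMap_lineParam {a b z : Plane} (h : a ≠ b) (ho : orient a b z = 0) :
    AffineMap.lineMap a b (lineParam a b z) = z := by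
  have hp := (sqLen_pos h).ne'
  unfold orient at ho
  apply ext_coord
  · rw [lineMap_coord, lineParam, div_mul_eq_mul_div, ← eq_sub_iff_add_eq', div_eq_iff hp, sqLen]
    linear_combination (b 1 - a 1) * ho
  · rw [lineMap_coord, lineParam, div_mul_eq_mul_div, ← eq_sub_iff_add_eq', div_eq_iff hp, sqLen]
    linear_combination (-(b 0 - a 0)) * ho

lemma lineParam_lineMap {a b : Plane} (h : a ≠ b) (t : ℝ) :
    lineParam a b (AffineMap.lineMap a b t) = t := by
  have hp := (sqLen_pos h).ne'
  rw [lineParam, div_eq_iff hp, lineMap_coord, lineMap_coord, sqLen]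
  ring

/-- Close to an inner point of a segment, the line through the segment is the segment. -/
lemma eventually_mem_openSegment {a b z₀ : Plane} (h : a ≠ b) (hz : z₀ ∈ openSegment ℝ a b) :
    ∀ᶠ z in 𝓝 z₀, orient a b z = 0 → z ∈ openSegment ℝ a b := by
  obtain ⟨t, h0, h1, rfl⟩ := mem_openSegment_iff.1 hz
  have hc := (continuous_lineParam a b).tendsto (AffineMap.lineMap a b t)
  rw [lineParam_lineMap h] at hc
  filter_upwards [hc.eventually (lt_mem_nhds h0), hc.eventually (gt_mem_nhds h1)] with z hz0 hz1 ho
  exact mem_openSegment_iff.2 ⟨_, hz0, hz1, lineMap_lineParam h ho⟩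

/-- Both sides of the line `ab` are met near each of its points. -/
lemma exists_orient_pos_neg {a b z₀ : Plane} (h : a ≠ b) (hz : orient a b z₀ = 0)
    {p : Plane → Prop} (hp : ∀ᶠ z in 𝓝 z₀, p z) :
    (∃ z, p z ∧ 0 < orient a b z) ∧ ∃ z, p z ∧ orient a b z < 0 := by
  have hl := sqLen_pos h
  let n : Plane := !₂[-(b 1 - a 1), b 0 - a 0]
  have hc : Continuous fun t : ℝ => z₀ + t • n := by fun_prop
  have ho : ∀ t : ℝ, orient a b (z₀ + t • n) = t * sqLen a b := by
    intro t
    unfold orient at hz ⊢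
    simp only [n, sqLen, PiLp.add_apply, PiLp.smul_apply, smul_eq_mul]
    simp
    linear_combination hz
  have h0 : ∀ᶠ t : ℝ in 𝓝 0, p (z₀ + t • n) := by
    have := hc.tendsto 0
    simp only [zero_smul, add_zero] at this
    exact this.eventually hp
  obtain ⟨δ, hδ, hb⟩ := Metric.eventually_nhds_iff.1 h0
  constructor
  · refine ⟨z₀ + (δ / 2) • n, hb ?_, ?_⟩
    · rw [Real.dist_eq, sub_zero, abs_of_pos (by linarith)]; linarith
    · rw [ho]; positivity
  · refine ⟨z₀ + (-(δ / 2)) • n, hb ?_, ?_⟩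
    · rw [Real.dist_eq, sub_zero, abs_neg, abs_of_pos (by linarith)]; linarith
    · rw [ho]; nlinarith

lemma dense_compl_segment (a b : Plane) : Dense (segment ℝ a b)ᶜ := by
  by_cases h : a = b
  · subst h
    rw [segment_same]
    exact dense_compl_singleton a
  intro z
  by_cases hz : orient a b z = 0
  · rw [mem_closure_iff_nhds]
    intro s hs
    obtain ⟨⟨w, hw, hw'⟩, -⟩ := exists_orient_pos_neg h hz (p := (· ∈ s)) hs
    exact ⟨w, hw, fun hm => hw'.ne' (orient_eq_zero_of_mem hm)⟩
  · exact subset_closure fun hm => hz (orient_eq_zero_of_mem hm)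

lemma isClosed_segment (a b : Plane) : IsClosed (segment ℝ a b) := by
  rw [segment_eq_image_lineMap]
  exact (isCompact_Icc.image AffineMap.lineMap_continuous).isClosed

lemma isCompact_segment (a b : Plane) : IsCompact (segment ℝ a b) := by
  rw [segment_eq_image_lineMap]
  exact isCompact_Icc.image AffineMap.lineMap_continuous

/-! ### Crossing parity of a vertical ray -/

open Classical in
/-- The parity of the number of crossings of the segment `ab` with the ray going down from `z`.
A segment is counted over the half-open interval of abscissae `[a 0, b 0)` (or `[b 0, a 0)`), so
that a vertical segment is never crossed. -/
noncomputable def rayCross (a b z : Plane) : ZMod 2 :=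
  if (a 0 ≤ z 0 ∧ z 0 < b 0 ∧ 0 < orient a b z) ∨
    (b 0 ≤ z 0 ∧ z 0 < a 0 ∧ orient a b z < 0) then 1 else 0

lemma rayCross_swap (a b z : Plane) : rayCross b a z = rayCross a b z := by
  unfold rayCross
  rw [orient_swap a b]
  congr 1
  simp only [Left.neg_pos_iff, Left.neg_neg_iff, eq_iff_iff]
  tauto

open Classical in
/-- The correction for an end point `p` of a segment when `z` moves near `z₀`. It is non-zero only
if `p` is straight below `z₀` and `z` lies to the left of `z₀`, where a ray may meet a segment with
end `p` although the ray from `z₀` does not, or the other way round. At each point, the corrections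
of the segments of a cycle cancel. -/
noncomputable def endCorr (z₀ p z : Plane) : ZMod 2 :=
  if p 0 = z₀ 0 ∧ p 1 < z₀ 1 ∧ z 0 < z₀ 0 then 1 else 0

lemma rayCross_off_of_le {a b z₀ : Plane} (hab : a ≠ b) (hle : a 0 ≤ b 0)
    (hz : z₀ ∉ segment ℝ a b) :
    ∀ᶠ z in 𝓝 z₀,
      rayCross a b z + endCorr z₀ a z + endCorr z₀ b z = rayCross a b z₀ := by
  have c0 := (continuous_coord 0).tendsto z₀
  have co := (continuous_orient a b).tendsto z₀
  have ha : z₀ ≠ a := fun h => hz (h ▸ left_mem_segment ℝ a b)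
  have hb : z₀ ≠ b := fun h => hz (h ▸ right_mem_segment ℝ a b)
  have one : (1 : ZMod 2) + 1 = 0 := CharTwo.add_self_eq_zero 1
  rcases lt_trichotomy (z₀ 0) (a 0) with h1 | h1 | h1
  · filter_upwards [c0.eventually (gt_mem_nhds h1)] with z hz
    have e1 : ¬ a 0 ≤ z 0 := not_le.2 hz
    have e2 : ¬ b 0 ≤ z 0 := by linarith
    have e3 : ¬ a 0 ≤ z₀ 0 := not_le.2 h1
    have e4 : ¬ b 0 ≤ z₀ 0 := by linarith
    have e5 : ¬ a 0 = z₀ 0 := h1.ne'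
    have e6 : ¬ b 0 = z₀ 0 := by intro h; linarith
    simp [rayCross, endCorr, e1, e2, e3, e4, e5, e6]
  · rcases hle.lt_or_eq with h2 | h2
    · have e6 : ¬ b 0 = z₀ 0 := by intro h; linarith
      have hne : z₀ 1 ≠ a 1 := fun h => ha (ext_coord h1 h)
      have oz : orient a b z₀ = (b 0 - a 0) * (z₀ 1 - a 1) := by unfold orient; rw [h1]; ring
      have hb0 : z₀ 0 < b 0 := by linarith
      rcases hne.lt_or_gt with h3 | h3
      · have on : orient a b z₀ < 0 := by rw [oz]; nlinarith
        filter_upwards [co.eventually (gt_mem_nhds on),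
          c0.eventually (gt_mem_nhds hb0)] with z e1 e2
        have e3 : ¬ b 0 ≤ z 0 := not_le.2 e2
        have e4 : ¬ b 0 ≤ z₀ 0 := not_le.2 hb0
        simp [rayCross, endCorr, e6, e1.not_gt, on.not_gt, e3, e4, h3.not_gt]
      · have on : 0 < orient a b z₀ := by rw [oz]; exact mul_pos (by linarith) (by linarith)
        filter_upwards [co.eventually (lt_mem_nhds on),
          c0.eventually (gt_mem_nhds hb0)] with z e1 e2
        by_cases e3 : a 0 ≤ z 0
        · simp [rayCross, endCorr, e1, on, e2, h1, e3, e3.not_gt, h2, h2.ne']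
        · have e4 : z 0 < a 0 := not_le.1 e3
          simp [rayCross, endCorr, e1.not_gt, on, h1, e3, h3, e4, h2, h2.ne']
    · -- The segment is vertical: both ends are below `z₀` or none is, so the corrections cancel.
      have hiff : a 1 < z₀ 1 ↔ b 1 < z₀ 1 := by
        have key : ∀ t : ℝ, 0 ≤ t → t ≤ 1 → a 1 + t * (b 1 - a 1) ≠ z₀ 1 := by
          intro t t0 t1 ht
          refine hz (mem_segment_iff.2 ⟨t, t0, t1, ext_coord ?_ ?_⟩)
          · rw [lineMap_coord, ← h2, h1]; ring
          · rw [lineMap_coord, ht]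
        have hne : b 1 - a 1 ≠ 0 := by
          intro h
          exact hab (ext_coord h2 (by linarith))
        by_contra hcon
        have h3 : a 1 ≤ z₀ 1 ∧ z₀ 1 ≤ b 1 ∨ b 1 ≤ z₀ 1 ∧ z₀ 1 ≤ a 1 := by
          by_cases x : a 1 < z₀ 1 <;> by_cases y : b 1 < z₀ 1
          · simp [x, y] at hcon
          · left; exact ⟨x.le, not_lt.1 y⟩
          · right; exact ⟨y.le, not_lt.1 x⟩
          · simp [x, y] at hcon
        have hs : a 1 + (z₀ 1 - a 1) / (b 1 - a 1) * (b 1 - a 1) = z₀ 1 := by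
          field_simp; ring
        refine key _ ?_ ?_ hs
        · rcases h3 with h3 | h3
          · exact div_nonneg (by linarith) (by linarith)
          · exact div_nonneg_of_nonpos (by linarith) (by linarith)
        · rcases h3 with h3 | h3
          · rw [div_le_one (lt_of_le_of_ne (by linarith) hne.symm)]; linarith
          · rw [div_le_one_of_neg (lt_of_le_of_ne (by linarith) hne)]; linarith
      refine Eventually.of_forall fun z => ?_
      have e1 : ∀ z : Plane, rayCross a b z = 0 := by
        intro z
        unfold rayCross
        rw [if_neg]
        rw [← h2]
        rintro (⟨h, h', -⟩ | ⟨h, h', -⟩) <;> linarith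
      have e2 : endCorr z₀ a z = endCorr z₀ b z := by
        unfold endCorr
        simp only [← h2, hiff]
      rw [e1, e1, e2, zero_add, CharTwo.add_self_eq_zero]
  · have e5 : ¬ a 0 = z₀ 0 := h1.ne
    rcases lt_trichotomy (z₀ 0) (b 0) with h2 | h2 | h2
    · have hne : orient a b z₀ ≠ 0 := by
        intro ho
        refine hz (mem_segment_iff.2 ⟨lineParam a b z₀, ?_, ?_, lineMap_lineParam hab ho⟩)
        all_goals
          have := congrArg (fun w : Plane => w 0) (lineMap_lineParam hab ho)
          simp only [lineMap_coord] at this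
          by_contra hcon
          nlinarith
      have e6 : ¬ b 0 = z₀ 0 := h2.ne'
      rcases hne.lt_or_gt with on | on
      · filter_upwards [co.eventually (gt_mem_nhds on), c0.eventually (gt_mem_nhds h2)] with z e1 e2
        have e3 : ¬ b 0 ≤ z 0 := not_le.2 e2
        simp [rayCross, endCorr, e5, e6, e1.not_gt, on.not_gt, e3, h2.not_ge]
      · filter_upwards [co.eventually (lt_mem_nhds on), c0.eventually (gt_mem_nhds h2),
          c0.eventually (lt_mem_nhds h1)] with z e1 e2 e3
        simp [rayCross, endCorr, e5, e6, e1, on, e2, h2, e3.le, h1.le]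
    · have hne : z₀ 1 ≠ b 1 := fun h => hb (ext_coord h2 h)
      have e6 : ¬ a 0 = b 0 := h2 ▸ e5
      have oz : orient a b z₀ = (b 0 - a 0) * (z₀ 1 - b 1) := by unfold orient; rw [h2]; ring
      rcases hne.lt_or_gt with h3 | h3
      · have on : orient a b z₀ < 0 := by rw [oz]; nlinarith
        filter_upwards [co.eventually (gt_mem_nhds on), c0.eventually (lt_mem_nhds h1)] with z e1 e2
        simp [rayCross, endCorr, e5, e1.not_gt, on.not_gt, e2.not_gt, h1.not_gt, h3.not_gt]
      · have on : 0 < orient a b z₀ := by rw [oz]; exact mul_pos (by linarith) (by linarith)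
        filter_upwards [co.eventually (lt_mem_nhds on), c0.eventually (lt_mem_nhds h1)] with z e1 e2
        by_cases e3 : z 0 < b 0
        · simp [rayCross, endCorr, e6, e1, e2.le, e3, h2, h3, on.not_gt, one]
        · simp [rayCross, endCorr, e6, e1.not_gt, e3, h2, on.not_gt]
    · filter_upwards [c0.eventually (lt_mem_nhds h1), c0.eventually (lt_mem_nhds h2)] with z e1 e2
      have e6 : ¬ b 0 = z₀ 0 := h2.ne
      simp [rayCross, endCorr, e5, e6, e1.not_gt, e2.not_gt, h1.not_gt, h2.not_gt]

/-- Away from the segment `ab`, the crossing parity is locally constant up to the corrections at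
the end points. -/
lemma rayCross_off {a b z₀ : Plane} (hab : a ≠ b) (hz : z₀ ∉ segment ℝ a b) :
    ∀ᶠ z in 𝓝 z₀,
      rayCross a b z + endCorr z₀ a z + endCorr z₀ b z = rayCross a b z₀ := by
  rcases le_total (a 0) (b 0) with h | h
  · exact rayCross_off_of_le hab h hz
  · filter_upwards [rayCross_off_of_le hab.symm h (by rwa [segment_symm])] with z hz'
    rw [rayCross_swap, rayCross_swap a b] at hz'
    rw [← hz']; ring

open Classical in
lemma rayCross_on_of_le {a b z₀ : Plane} (hle : a 0 ≤ b 0) (hab : a ≠ b)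
    (hz : z₀ ∈ openSegment ℝ a b) :
    ∃ κ : ZMod 2, ∀ᶠ z in 𝓝 z₀, orient a b z ≠ 0 →
      rayCross a b z + endCorr z₀ a z + endCorr z₀ b z =
        κ + if 0 < orient a b z then 1 else 0 := by
  have c0 := (continuous_coord 0).tendsto z₀
  obtain ⟨t, t0, t1, rfl⟩ := mem_openSegment_iff.1 hz
  set z₀ : Plane := AffineMap.lineMap a b t with hz₀
  have x0 : z₀ 0 = a 0 + t * (b 0 - a 0) := lineMap_coord ..
  have x1 : z₀ 1 = a 1 + t * (b 1 - a 1) := lineMap_coord ..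
  rcases hle.lt_or_eq with h | h
  · have h1 : a 0 < z₀ 0 := by rw [x0]; nlinarith
    have h2 : z₀ 0 < b 0 := by rw [x0]; nlinarith
    refine ⟨0, ?_⟩
    filter_upwards [c0.eventually (lt_mem_nhds h1), c0.eventually (gt_mem_nhds h2)] with z e1 e2 _
    simp [rayCross, endCorr, h1.ne, h2.ne', e1.le, e2, e2.not_ge]
  · -- The segment is vertical: it is never crossed, and exactly one of its ends is below `z₀`.
    have hx : z₀ 0 = a 0 := by rw [x0, h]; ring
    have hy : b 1 - a 1 ≠ 0 := fun hy => hab (ext_coord h (by linarith))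
    have e1 : ∀ z : Plane, rayCross a b z = 0 := by
      intro z
      unfold rayCross
      rw [if_neg]
      rw [← h]
      rintro (⟨h, h', -⟩ | ⟨h, h', -⟩) <;> linarith
    have eo : ∀ z, orient a b z = (b 1 - a 1) * (z₀ 0 - z 0) := by
      intro z; unfold orient; rw [hx, h]; ring
    have one : (1 : ZMod 2) + 1 = 0 := CharTwo.add_self_eq_zero 1
    rcases hy.lt_or_gt with hy | hy
    · have l1 : ¬ a 1 < z₀ 1 := by rw [x1]; nlinarith
      have l2 : b 1 < z₀ 1 := by rw [x1]; nlinarith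
      refine ⟨1, Eventually.of_forall fun z hne => ?_⟩
      have : 0 < orient a b z ↔ ¬ z 0 < z₀ 0 := by
        rw [eo] at hne ⊢
        have hne' : z₀ 0 - z 0 ≠ 0 := right_ne_zero_of_mul hne
        constructor
        · intro hp; nlinarith
        · intro hp
          exact mul_pos_of_neg_of_neg hy (lt_of_le_of_ne (by linarith) hne')
      rw [e1]
      by_cases hl : z 0 < z₀ 0 <;> simp [endCorr, this, hl, l1, l2, ← h, one]
      all_goals simp_all
    · have l1 : a 1 < z₀ 1 := by rw [x1]; nlinarith
      have l2 : ¬ b 1 < z₀ 1 := by rw [x1]; nlinarith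
      refine ⟨0, Eventually.of_forall fun z hne => ?_⟩
      have : 0 < orient a b z ↔ z 0 < z₀ 0 := by
        rw [eo]
        constructor
        · intro hp; by_contra hc; nlinarith
        · intro hp; exact mul_pos hy (by linarith)
      rw [e1]
      by_cases hl : z 0 < z₀ 0 <;> simp [endCorr, this, hl, l1, l2, ← h]
      all_goals simp_all

open Classical in
/-- Close to an inner point of the segment `ab`, the corrected crossing parity jumps by one across
the segment. -/
lemma rayCross_on {a b z₀ : Plane} (hab : a ≠ b) (hz : z₀ ∈ openSegment ℝ a b) :
    ∃ κ : ZMod 2, ∀ᶠ z in 𝓝 z₀, orient a b z ≠ 0 →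
      rayCross a b z + endCorr z₀ a z + endCorr z₀ b z =
        κ + if 0 < orient a b z then 1 else 0 := by
  rcases le_total (a 0) (b 0) with h | h
  · exact rayCross_on_of_le h hab hz
  · obtain ⟨κ, hκ⟩ := rayCross_on_of_le h hab.symm (by rwa [openSegment_symm])
    refine ⟨κ + 1, ?_⟩
    filter_upwards [hκ] with z hz' hne
    have one : (1 : ZMod 2) + 1 = 0 := CharTwo.add_self_eq_zero 1
    rw [orient_swap a b, rayCross_swap a b] at hz'
    have := hz' (neg_ne_zero.2 hne)
    rw [show rayCross a b z + endCorr z₀ a z + endCorr z₀ b z =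
      rayCross a b z + endCorr z₀ b z + endCorr z₀ a z by ring, this]
    rcases hne.lt_or_gt with ho | ho
    · rw [if_pos (by linarith), if_neg (by linarith)]; ring
    · rw [if_neg (by linarith), if_pos ho, add_assoc, one]

end Plane

/-! ### Systems of straight segments and their faces -/

/-- A family of non-degenerate segments in the plane such that two different ones meet only in
common end points. -/
structure SegSystem (I : Type*) where
  /-- the first end point of a segment -/
  a : I → Plane
  /-- the second end point of a segment -/
  b : I → Plane
  ne : ∀ i, a i ≠ b i
  meet : ∀ i j, i ≠ j → ∀ z, z ∈ segment ℝ (a i) (b i) → z ∈ segment ℝ (a j) (b j) →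
    (z = a i ∨ z = b i) ∧ (z = a j ∨ z = b j)

namespace SegSystem

open Plane

variable {I : Type*} (S : SegSystem I)

/-- The complement of the union of the segments. -/
def region : Set Plane := {z | ∀ i, z ∉ segment ℝ (S.a i) (S.b i)}

/-- `p` is an end point of the segment `i`. -/
def IsEnd (p : Plane) (i : I) : Prop := p = S.a i ∨ p = S.b i

lemma notMem_ends_of_mem_openSegment {a b z : Plane} (hab : a ≠ b) (hz : z ∈ openSegment ℝ a b) :
    z ≠ a ∧ z ≠ b := by
  constructor
  · rintro rfl; exact hab (left_mem_openSegment_iff.1 hz)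
  · rintro rfl; exact hab (right_mem_openSegment_iff.1 hz)

lemma notMem_of_mem_openSegment {i j : I} (hij : j ≠ i) {z : Plane}
    (hz : z ∈ openSegment ℝ (S.a i) (S.b i)) : z ∉ segment ℝ (S.a j) (S.b j) := by
  intro h
  have := notMem_ends_of_mem_openSegment (S.ne i) hz
  rcases (S.meet i j hij.symm z (openSegment_subset_segment _ _ _ hz) h).1 with h | h
  · exact this.1 h
  · exact this.2 h

variable [Fintype I]

open Classical in
/-- The boundary map modulo 2, with values in functions on all points of the plane. -/
noncomputable def boundary : (I → ZMod 2) →ₗ[ZMod 2] (Plane → ZMod 2) where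
  toFun c p := ∑ i, c i * ((if S.a i = p then 1 else 0) + if S.b i = p then 1 else 0)
  map_add' c d := by
    ext p; simp [add_mul, Finset.sum_add_distrib]
  map_smul' t c := by
    ext p; simp [mul_assoc, Finset.mul_sum]

/-- The cycle space modulo 2. -/
noncomputable abbrev Cyc : Type _ := LinearMap.ker S.boundary

noncomputable instance : Fintype S.Cyc := Fintype.ofFinite _

/-- The end points of all segments. -/
def ends : Set Plane := range S.a ∪ range S.b

lemma finite_ends : S.ends.Finite := (finite_range _).union (finite_range _)

/-- For a cycle, the corrections at the end points cancel. -/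
lemma sum_endCorr (c : S.Cyc) (z₀ z : Plane) :
    ∑ i, c.1 i * (endCorr z₀ (S.a i) z + endCorr z₀ (S.b i) z) = 0 := by
  classical
  have key : ∀ p : Plane, p ∈ S.finite_ends.toFinset →
      endCorr z₀ p z = ∑ q ∈ S.finite_ends.toFinset, (if p = q then 1 else 0) * endCorr z₀ q z := by
    intro p hp
    simp only [ite_mul, one_mul, zero_mul]
    rw [Finset.sum_ite_eq, if_pos hp]
  have ha : ∀ i, S.a i ∈ S.finite_ends.toFinset := fun i =>
    S.finite_ends.mem_toFinset.2 (Or.inl ⟨i, rfl⟩)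
  have hb : ∀ i, S.b i ∈ S.finite_ends.toFinset := fun i =>
    S.finite_ends.mem_toFinset.2 (Or.inr ⟨i, rfl⟩)
  calc ∑ i, c.1 i * (endCorr z₀ (S.a i) z + endCorr z₀ (S.b i) z)
      = ∑ i, ∑ q ∈ S.finite_ends.toFinset,
        c.1 i * ((if S.a i = q then 1 else 0) + if S.b i = q then 1 else 0) * endCorr z₀ q z := by
        refine Finset.sum_congr rfl fun i _ => ?_
        rw [key _ (ha i), key _ (hb i), ← Finset.sum_add_distrib, Finset.mul_sum]
        refine Finset.sum_congr rfl fun q _ => ?_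
        ring
    _ = ∑ q ∈ S.finite_ends.toFinset, S.boundary c.1 q * endCorr z₀ q z := by
        rw [Finset.sum_comm]
        refine Finset.sum_congr rfl fun q _ => ?_
        rw [← Finset.sum_mul]; rfl
    _ = 0 := by
        refine Finset.sum_eq_zero fun q _ => ?_
        rw [LinearMap.mem_ker.1 c.2]; simp

/-- The label of a point: for each cycle, the parity of its crossings with the ray going down from
the point. Labels are meaningful on `S.region`, where they are locally constant. -/
noncomputable def label (z : Plane) : S.Cyc → ZMod 2 :=
  fun c => ∑ i, c.1 i * rayCross (S.a i) (S.b i) z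

lemma label_eq (c : S.Cyc) (z₀ z : Plane) :
    S.label z c = ∑ i, c.1 i * (rayCross (S.a i) (S.b i) z + endCorr z₀ (S.a i) z +
      endCorr z₀ (S.b i) z) := by
  have := S.sum_endCorr c z₀ z
  rw [label, ← add_zero (∑ i, _ * _), ← this, ← Finset.sum_add_distrib]
  exact Finset.sum_congr rfl fun i _ => by ring

/-- Labels are locally constant off the segments. -/
lemma label_eventually_eq {z₀ : Plane} (hz : z₀ ∈ S.region) :
    ∀ᶠ z in 𝓝 z₀, S.label z = S.label z₀ := by
  have := eventually_all.2 fun i => rayCross_off (S.ne i) (hz i)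
  filter_upwards [this] with z hz
  ext c
  rw [S.label_eq c z₀ z, label]
  exact Finset.sum_congr rfl fun i _ => by rw [hz i]

open Classical in
/-- Across the segment `i`, the label for a cycle `c` changes by the coefficient `c i`. -/
lemma label_near_openSegment {i : I} {z₀ : Plane} (hz : z₀ ∈ openSegment ℝ (S.a i) (S.b i)) :
    ∃ κ : S.Cyc → ZMod 2, ∀ᶠ z in 𝓝 z₀, orient (S.a i) (S.b i) z ≠ 0 →
      ∀ c, S.label z c = κ c + c.1 i * if 0 < orient (S.a i) (S.b i) z then 1 else 0 := by
  obtain ⟨κ, hκ⟩ := rayCross_on (S.ne i) hz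
  refine ⟨fun c => c.1 i * κ + ∑ j ∈ Finset.univ.erase i, c.1 j * rayCross (S.a j) (S.b j) z₀, ?_⟩
  have := eventually_all.2 fun j : {j // j ≠ i} =>
    rayCross_off (S.ne j) (S.notMem_of_mem_openSegment j.2 hz)
  filter_upwards [this, hκ] with z hz hi ho c
  have he : ∀ j ∈ Finset.univ.erase i, c.1 j * (rayCross (S.a j) (S.b j) z +
      endCorr z₀ (S.a j) z + endCorr z₀ (S.b j) z) = c.1 j * rayCross (S.a j) (S.b j) z₀ :=
    fun j hj => by rw [hz ⟨j, Finset.ne_of_mem_erase hj⟩]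
  rw [S.label_eq c z₀ z, ← Finset.add_sum_erase _ _ (Finset.mem_univ i), hi ho,
    Finset.sum_congr rfl he]
  ring

/-- Points close to an inner point of a segment lie on that segment or on none. -/
lemma eventually_mem_region {i : I} {z₀ : Plane} (hz : z₀ ∈ openSegment ℝ (S.a i) (S.b i)) :
    ∀ᶠ z in 𝓝 z₀, z ∉ segment ℝ (S.a i) (S.b i) → z ∈ S.region := by
  have := eventually_all.2 fun j : {j // j ≠ i} =>
    (isClosed_segment (S.a j) (S.b j)).isOpen_compl.mem_nhds
      (S.notMem_of_mem_openSegment j.2 hz)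
  filter_upwards [this] with z hz hi j
  by_cases h : j = i
  · exact h ▸ hi
  · exact hz ⟨j, h⟩

lemma midpoint_mem_openSegment (x y : Plane) : midpoint ℝ x y ∈ openSegment ℝ x y :=
  mem_openSegment_iff.2 ⟨⅟2, by norm_num, by norm_num, rfl⟩

/-- The label to the right of the segment `i`, taken at the midpoint; `label_sides` shows that it is
the same along the whole segment. -/
noncomputable def rightLabel (i : I) : S.Cyc → ZMod 2 :=
  (S.label_near_openSegment (midpoint_mem_openSegment (S.a i) (S.b i))).choose

/-- The label to the left of the segment `i`. -/
noncomputable def leftLabel (i : I) : S.Cyc → ZMod 2 := fun c => S.rightLabel i c + c.1 i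

/-- Along the whole open segment `i`, the labels on its two sides are `leftLabel i` and
`rightLabel i`. -/
lemma label_sides {i : I} {z₀ : Plane} (hz : z₀ ∈ openSegment ℝ (S.a i) (S.b i)) :
    ∀ᶠ z in 𝓝 z₀, (0 < orient (S.a i) (S.b i) z → S.label z = S.leftLabel i) ∧
      (orient (S.a i) (S.b i) z < 0 → S.label z = S.rightLabel i) := by
  classical
  have right : ∀ {κ : S.Cyc → ZMod 2} {z₁ : Plane}, (∀ᶠ z in 𝓝 z₁,
      orient (S.a i) (S.b i) z ≠ 0 → ∀ c, S.label z c =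
        κ c + c.1 i * if 0 < orient (S.a i) (S.b i) z then 1 else 0) →
      ∀ᶠ z in 𝓝 z₁, orient (S.a i) (S.b i) z < 0 → S.label z = κ := by
    intro κ z₁ h
    filter_upwards [h] with z hz ho
    ext c
    rw [hz ho.ne c, if_neg ho.not_gt, mul_zero, add_zero]
  have onl : ∀ {z₁ : Plane}, z₁ ∈ openSegment ℝ (S.a i) (S.b i) → orient (S.a i) (S.b i) z₁ = 0 :=
    fun h => orient_eq_zero_of_mem (openSegment_subset_segment _ _ _ h)
  have hmid := (S.label_near_openSegment (midpoint_mem_openSegment (S.a i) (S.b i))).choose_spec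
  let U : Set Plane := {z₁ | ∀ᶠ z in 𝓝 z₁,
    orient (S.a i) (S.b i) z < 0 → S.label z = S.rightLabel i}
  let W : Set Plane := {z₁ | ∀ᶠ z in 𝓝 z₁,
    orient (S.a i) (S.b i) z < 0 → S.label z ≠ S.rightLabel i}
  have hU : IsOpen U := isOpen_iff_mem_nhds.2 fun z₁ h => eventually_eventually_nhds.2 h
  have hW : IsOpen W := isOpen_iff_mem_nhds.2 fun z₁ h => eventually_eventually_nhds.2 h
  have hcon : IsPreconnected (openSegment ℝ (S.a i) (S.b i)) :=
    (convex_openSegment _ _).isPreconnected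
  have hsub : openSegment ℝ (S.a i) (S.b i) ⊆ U ∪ W := by
    intro z₁ h₁
    obtain ⟨κ, hκ⟩ := S.label_near_openSegment h₁
    by_cases h : κ = S.rightLabel i
    · left
      rw [h] at hκ
      exact right hκ
    · right
      filter_upwards [right hκ] with z hz ho
      rw [hz ho]
      exact h
  have hzU : z₀ ∈ U := by
    by_contra hn
    obtain ⟨z₁, h₁, hu, hw⟩ := hcon U W hU hW hsub
      ⟨_, midpoint_mem_openSegment _ _, right hmid⟩ ⟨z₀, hz, (hsub hz).resolve_left hn⟩
    obtain ⟨-, z, ⟨h2, h3⟩, ho⟩ := exists_orient_pos_neg (S.ne i) (onl h₁) (hu.and hw)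
    exact h3 ho (h2 ho)
  obtain ⟨κ, hκ⟩ := S.label_near_openSegment hz
  have hk : κ = S.rightLabel i := by
    obtain ⟨-, z, ⟨h2, h3⟩, ho⟩ := exists_orient_pos_neg (S.ne i) (onl hz) (hzU.and (right hκ))
    rw [← h2 ho, h3 ho]
  filter_upwards [hzU, hκ] with z h1 h2
  refine ⟨fun ho => ?_, h1⟩
  ext c
  rw [h2 ho.ne' c, if_pos ho, mul_one, hk, leftLabel]

/-- The labels that occur. They are the faces, up to a possible identification of components of
the region that no cycle tells apart. -/
def faces : Set (S.Cyc → ZMod 2) := S.label '' S.region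

lemma left_right_mem_faces (i : I) : S.leftLabel i ∈ S.faces ∧ S.rightLabel i ∈ S.faces := by
  have hm := midpoint_mem_openSegment (S.a i) (S.b i)
  obtain ⟨⟨z, ⟨h1, h2⟩, h3⟩, ⟨w, ⟨h4, h5⟩, h6⟩⟩ := exists_orient_pos_neg (S.ne i)
    (orient_eq_zero_of_mem (openSegment_subset_segment _ _ _ hm))
    ((S.eventually_mem_region hm).and (S.label_sides hm))
  exact ⟨⟨z, h1 fun h => h3.ne' (orient_eq_zero_of_mem h), h2.1 h3⟩,
    ⟨w, h4 fun h => h6.ne (orient_eq_zero_of_mem h), h5.2 h6⟩⟩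

lemma dense_region : Dense S.region := by
  have : S.region = ⋂ i, (segment ℝ (S.a i) (S.b i))ᶜ := by
    ext z; simp [region]
  rw [this]
  exact dense_iInter_of_isOpen (fun i => (isClosed_segment _ _).isOpen_compl)
    fun i => dense_compl_segment _ _

/-- The part of Euler's formula that rests on the separation of the plane by cycles: there are at
least `|I| + 1 - |ends|` faces, because the faces tell all cycles apart. -/
lemma card_add_one_le : Fintype.card I + 1 ≤ S.faces.ncard + S.ends.ncard := by
  classical
  have : Fintype S.faces := Fintype.ofFinite _
  have : Fintype S.ends := S.finite_ends.fintype
  have : Fintype (LinearMap.range (S.boundary)) := by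
    have : Finite (LinearMap.range (S.boundary)) :=
      (Set.finite_range S.boundary).to_subtype
    exact Fintype.ofFinite _
  -- The two sides of a segment `i` give the value of a cycle at `i`, so a cycle is determined, even
  -- after a constant has been added, by its values on the faces.
  have h1 : Fintype.card (S.Cyc × ZMod 2) ≤ Fintype.card (S.faces → ZMod 2) := by
    refine Fintype.card_le_of_injective (fun c (α : S.faces) => α.1 c.1 + c.2) ?_
    rintro ⟨c, s⟩ ⟨d, t⟩ h
    have h' : ∀ α ∈ S.faces, α c + s = α d + t := fun α hα => congrFun h ⟨α, hα⟩
    have hcd : c = d := by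
      ext i
      have e1 := h' _ (S.left_right_mem_faces i).1
      have e2 := h' _ (S.left_right_mem_faces i).2
      simp only [leftLabel] at e1
      linear_combination e1 - e2
    subst hcd
    obtain ⟨z, hz⟩ := S.dense_region.nonempty
    have := h' _ ⟨z, hz, rfl⟩
    rw [add_left_cancel this]
  have h2 : Fintype.card (LinearMap.range S.boundary) ≤ Fintype.card (S.ends → ZMod 2) := by
    refine Fintype.card_le_of_injective (fun f p => f.1 p.1) ?_
    rintro ⟨_, c, rfl⟩ ⟨_, d, rfl⟩ h
    ext p
    by_cases hp : p ∈ S.ends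
    · exact congrFun h ⟨p, hp⟩
    · have : ∀ i, S.a i ≠ p ∧ S.b i ≠ p := fun i =>
        ⟨fun h => hp (Or.inl ⟨i, h⟩), fun h => hp (Or.inr ⟨i, h⟩)⟩
      simp [boundary, this]
  have h3 : Fintype.card (I → ZMod 2) =
      Fintype.card S.Cyc * Fintype.card (LinearMap.range S.boundary) := by
    have e := S.boundary.quotKerEquivRange
    have := Submodule.card_eq_card_quotient_mul_card (LinearMap.ker S.boundary)
    rw [Nat.card_congr e.toEquiv] at this
    rw [← Nat.card_eq_fintype_card, ← Nat.card_eq_fintype_card, ← Nat.card_eq_fintype_card,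
      this, mul_comm]
  rw [Fintype.card_prod, ZMod.card, Fintype.card_fun, ZMod.card] at h1
  rw [Fintype.card_fun, ZMod.card] at h2 h3
  have h4 : 2 ^ (Fintype.card I + 1) ≤ 2 ^ (S.faces.ncard + S.ends.ncard) := by
    rw [← Nat.card_coe_set_eq, ← Nat.card_coe_set_eq, Nat.card_eq_fintype_card,
      Nat.card_eq_fintype_card, pow_succ, h3, pow_add]
    calc _ = (Fintype.card S.Cyc * 2) * Fintype.card (LinearMap.range S.boundary) := by ring
      _ ≤ _ := Nat.mul_le_mul h1 h2
  exact (Nat.pow_le_pow_iff_right (by norm_num)).1 h4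

end SegSystem

/-! ### The boundary of a face -/

namespace SegSystem

open Plane

variable {I : Type*} [Fintype I] (S : SegSystem I)

/-- The segment `i` separates the face `α` from another face. -/
def Jumps (α : S.Cyc → ZMod 2) (i : I) : Prop := ¬ (S.leftLabel i = α ↔ S.rightLabel i = α)

/-- Close to `q`, either all points of the region belong to the face `α` or none does. -/
def Settled (α : S.Cyc → ZMod 2) (q : Plane) : Prop :=
  ∃ b : Prop, ∀ᶠ z in 𝓝 q, z ∈ S.region → (S.label z = α ↔ b)

variable {S} {α : S.Cyc → ZMod 2}

lemma settled_of_mem_region {q : Plane} (hq : q ∈ S.region) : S.Settled α q := by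
  refine ⟨S.label q = α, ?_⟩
  filter_upwards [S.label_eventually_eq hq] with z hz _
  rw [hz]

lemma settled_of_mem_openSegment {i : I} (hi : ¬ S.Jumps α i) {q : Plane}
    (hq : q ∈ openSegment ℝ (S.a i) (S.b i)) : S.Settled α q := by
  refine ⟨S.leftLabel i = α, ?_⟩
  filter_upwards [S.label_sides hq, eventually_mem_openSegment (S.ne i) hq] with z hz hz' hr
  rcases lt_trichotomy (orient (S.a i) (S.b i) z) 0 with h | h | h
  · rw [hz.2 h, not_not.1 hi]
  · exact absurd (openSegment_subset_segment _ _ _ (hz' h)) (hr i)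
  · rw [hz.1 h]

/-- On a connected set of settled points, either all points of the region belong to `α` or none
does. The density of the region rules out that a point is settled in both ways. -/
lemma exists_of_isPreconnected {C : Set Plane} (hC : IsPreconnected C)
    (h : ∀ q ∈ C, S.Settled α q) :
    ∃ b : Prop, ∀ z ∈ C, z ∈ S.region → (S.label z = α ↔ b) := by
  by_contra hcon
  push Not at hcon
  let U : Prop → Set Plane := fun b => {q | ∀ᶠ z in 𝓝 q, z ∈ S.region → (S.label z = α ↔ b)}
  have hU : ∀ b, IsOpen (U b) := fun b =>
    isOpen_iff_mem_nhds.2 fun z₁ h => eventually_eventually_nhds.2 h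
  have hsub : C ⊆ U True ∪ U False := by
    intro q hq
    obtain ⟨b, hb⟩ := h q hq
    by_cases hbt : b
    · left; rwa [eq_true hbt] at hb
    · right; rwa [eq_false hbt] at hb
  have hmem : ∀ b : Prop, ∃ z ∈ C, z ∈ U b := by
    intro b
    obtain ⟨z, hz, hr, hn⟩ := hcon (¬ b)
    refine ⟨z, hz, ?_⟩
    rcases hsub hz with h | h
    · have := mem_of_mem_nhds h hr
      have hb : b = True := by
        by_cases hbt : b
        · exact eq_true hbt
        · simp_all
      rw [hb]; exact h
    · have := mem_of_mem_nhds h hr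
      have hb : b = False := by
        by_cases hbt : b
        · simp_all
        · exact eq_false hbt
      rw [hb]; exact h
  obtain ⟨q, -, h1, h2⟩ := hC _ _ (hU True) (hU False) hsub (hmem True) (hmem False)
  obtain ⟨z, ⟨hz1, hz2⟩, hz⟩ := mem_closure_iff_nhds.1 (S.dense_region q) _
    (Filter.inter_mem h1 h2)
  exact (hz2 hz).1 ((hz1 hz).2 trivial)

/-- A disc from which a radius has been removed is connected. -/
lemma isPreconnected_slit (q d : Plane) (hd : d ≠ 0) {r : ℝ} (hr : 0 < r) :
    IsPreconnected {z ∈ Metric.ball q r | ∀ t : ℝ, 0 ≤ t → z ≠ q + t • d} := by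
  set T : Set Plane := {z ∈ Metric.ball q r | ∀ t : ℝ, 0 ≤ t → z ≠ q + t • d} with hT
  have hdn : 0 < ‖d‖ := norm_pos_iff.2 hd
  set s : ℝ := r / (2 * ‖d‖) with hs
  have hs0 : 0 < s := by positivity
  have hb : q + (-s) • d ∈ Metric.ball q r := by
    rw [Metric.mem_ball, dist_eq_norm, add_sub_cancel_left, norm_smul, norm_neg, Real.norm_eq_abs,
      abs_of_pos hs0, hs]
    rw [div_mul_eq_mul_div, div_lt_iff₀ (by positivity)]
    nlinarith [mul_pos hr hdn]
  have hc : ∀ t : ℝ, 0 ≤ t → q + (-s) • d ≠ q + t • d := by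
    intro t ht h
    have := smul_left_injective ℝ hd (add_left_cancel h)
    linarith
  have hstar : StarConvex ℝ (q + (-s) • d) T := by
    rintro y ⟨hy, hy'⟩ a b ha hb' hab
    refine ⟨convex_ball q r hb hy ha hb' hab, fun t ht h => ?_⟩
    rcases hb'.eq_or_lt with h0 | h0
    · subst h0
      have : a = 1 := by linarith
      subst this
      rw [one_smul, zero_smul, add_zero] at h
      exact hc t ht h
    · refine hy' ((t + a * s) / b) (by positivity) ?_
      have ha' : a = 1 - b := by linarith
      subst ha'
      have : b • (y - q) = (t + (1 - b) * s) • d := by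
        have h2 : b • y = q + t • d - (1 - b) • (q + (-s) • d) := by rw [← h]; abel
        rw [smul_sub, h2]; module
      rw [← sub_eq_iff_eq_add', div_eq_inv_mul, mul_smul, ← this, smul_smul, inv_mul_cancel₀ h0.ne',
        one_smul]
  exact (hstar.isPathConnected ⟨hb, hc⟩).isConnected.isPreconnected

/-- If, of all segments at `q`, only `i` may separate `α` from other faces, then nothing changes
around `q`: go around `q` from one side of `i` to the other. -/
lemma settled_of_isEnd {q : Plane} {i : I} (hq : S.IsEnd q i)
    (h : ∀ j, S.IsEnd q j → j ≠ i → ¬ S.Jumps α j) : S.Settled α q := by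
  obtain ⟨p, hpq, hseg⟩ : ∃ p, p ≠ q ∧ segment ℝ (S.a i) (S.b i) = segment ℝ q p := by
    rcases hq with rfl | rfl
    · exact ⟨_, (S.ne i).symm, rfl⟩
    · exact ⟨_, S.ne i, segment_symm ..⟩
  have hqi : q ∈ segment ℝ (S.a i) (S.b i) := hseg ▸ left_mem_segment ℝ q p
  have hnear : ∀ᶠ z in 𝓝 q, ∀ j, z ∈ segment ℝ (S.a j) (S.b j) →
      S.IsEnd q j ∧ (z = S.a j → z = q) ∧ (z = S.b j → z = q) := by
    refine eventually_all.2 fun j => ?_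
    by_cases hj : S.IsEnd q j
    · have e1 : ∀ x : Plane, ∀ᶠ z in 𝓝 q, z = x → z = q := by
        intro x
        by_cases hx : x = q
        · exact Eventually.of_forall fun z hz => hz.trans hx
        · filter_upwards [isOpen_compl_singleton.mem_nhds (Ne.symm hx : q ∈ ({x} : Set Plane)ᶜ)]
            with z hz hzx using absurd hzx hz
      filter_upwards [e1 (S.a j), e1 (S.b j)] with z h1 h2 _ using ⟨hj, h1, h2⟩
    · have : q ∉ segment ℝ (S.a j) (S.b j) := by
        intro hm
        by_cases hij : i = j
        · exact hj (hij ▸ hq)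
        · exact hj (S.meet i j hij q hqi hm).2
      filter_upwards [(isClosed_segment _ _).isOpen_compl.mem_nhds this] with z hz hm
      exact absurd hm hz
  obtain ⟨r', hr', hball⟩ := Metric.eventually_nhds_iff_ball.1 hnear
  have hd : p - q ≠ 0 := sub_ne_zero.2 hpq
  have hdn : 0 < ‖p - q‖ := norm_pos_iff.2 hd
  set r := min r' ‖p - q‖ with hr
  have hr0 : 0 < r := lt_min hr' hdn
  have hray : ∀ z, z ∈ segment ℝ (S.a i) (S.b i) → ∃ t : ℝ, 0 ≤ t ∧ z = q + t • (p - q) := by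
    intro z hz
    rw [hseg] at hz
    obtain ⟨t, t0, -, rfl⟩ := mem_segment_iff.1 hz
    exact ⟨t, t0, by rw [AffineMap.lineMap_apply, vsub_eq_sub, vadd_eq_add, add_comm]⟩
  obtain ⟨b, hb⟩ := exists_of_isPreconnected (α := α) (isPreconnected_slit q (p - q) hd hr0)
    (fun z ⟨hz, hz'⟩ => by
      by_cases hzr : z ∈ S.region
      · exact settled_of_mem_region hzr
      · obtain ⟨j, hj⟩ : ∃ j, z ∈ segment ℝ (S.a j) (S.b j) := by
          simpa [region] using hzr
        have hzq : z ≠ q := by simpa using hz' 0 le_rfl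
        obtain ⟨h1, h2, h3⟩ := hball z (Metric.ball_subset_ball (min_le_left _ _) hz) j hj
        have hji : j ≠ i := by
          rintro rfl
          obtain ⟨t, t0, ht⟩ := hray z hj
          exact hz' t t0 ht
        exact settled_of_mem_openSegment (h j h1 hji) (mem_openSegment_of_ne_left_right
          (fun h => hzq (h2 h.symm)) (fun h => hzq (h3 h.symm)) hj))
  refine ⟨b, ?_⟩
  filter_upwards [Metric.ball_mem_nhds q hr0] with z hz hzr
  refine hb z ⟨hz, ?_⟩ hzr
  rintro t t0 rfl
  refine hzr i (hseg ▸ mem_segment_iff.2 ⟨t, t0, ?_, ?_⟩)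
  · have h1 : ‖t • (p - q)‖ < ‖p - q‖ := by
      have := Metric.mem_ball.1 hz
      rw [dist_eq_norm, add_sub_cancel_left] at this
      exact this.trans_le (min_le_right _ _)
    rw [norm_smul, Real.norm_eq_abs, abs_of_nonneg t0] at h1
    nlinarith
  · rw [AffineMap.lineMap_apply, vsub_eq_sub, vadd_eq_add, add_comm]

/-- The boundary of a face has no loose ends. -/
lemma exists_jumps_ne {q : Plane} {i : I} (hq : S.IsEnd q i) (hi : S.Jumps α i) :
    ∃ j, j ≠ i ∧ S.IsEnd q j ∧ S.Jumps α j := by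
  by_contra! hcon
  obtain ⟨b, hb⟩ := settled_of_isEnd (α := α) hq fun j h1 h2 => hcon j h2 h1
  have hcl : q ∈ closure (openSegment ℝ (S.a i) (S.b i)) := by
    rw [closure_openSegment]
    rcases hq with rfl | rfl
    · exact left_mem_segment ..
    · exact right_mem_segment ..
  obtain ⟨w, hw, hwo⟩ : ∃ w, (∀ᶠ z in 𝓝 w, z ∈ S.region → (S.label z = α ↔ b)) ∧
      w ∈ openSegment ℝ (S.a i) (S.b i) :=
    mem_closure_iff_nhds.1 hcl _ (eventually_eventually_nhds.2 hb)
  obtain ⟨⟨z, ⟨h1, h2, h3⟩, ho⟩, ⟨z', ⟨h1', h2', h3'⟩, ho'⟩⟩ := exists_orient_pos_neg (S.ne i)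
    (orient_eq_zero_of_mem (openSegment_subset_segment _ _ _ hwo))
    (hw.and ((S.eventually_mem_region hwo).and (S.label_sides hwo)))
  apply hi
  rw [← h3.1 ho, ← h3'.2 ho', h1 (h2 fun h => ho.ne' (orient_eq_zero_of_mem h)),
    h1' (h2' fun h => ho'.ne (orient_eq_zero_of_mem h))]

/-- If there are at least two faces, every face has a boundary. -/
lemma exists_jumps {β : S.Cyc → ZMod 2} (hα : α ∈ S.faces) (hβ : β ∈ S.faces) (hne : α ≠ β) :
    ∃ i, S.Jumps α i := by
  by_contra! hcon
  obtain ⟨b, hb⟩ := exists_of_isPreconnected (α := α) isPreconnected_univ fun q _ => by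
    by_cases hq : q ∈ S.region
    · exact settled_of_mem_region hq
    · obtain ⟨i, hi⟩ : ∃ i, q ∈ segment ℝ (S.a i) (S.b i) := by simpa [region] using hq
      by_cases he : S.IsEnd q i
      · exact settled_of_isEnd he fun j _ _ => hcon j
      · exact settled_of_mem_openSegment (hcon i) (mem_openSegment_of_ne_left_right
          (fun h => he (Or.inl h.symm)) (fun h => he (Or.inr h.symm)) hi)
  obtain ⟨z, hz, rfl⟩ := hα
  obtain ⟨w, hw, rfl⟩ := hβ
  exact hne ((hb w (mem_univ _) hw).2 ((hb z (mem_univ _) hz).1 rfl)).symm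

end SegSystem

/-! ### Polygonal paths -/

/-- The points `p 0, …, p n` are the successive corners of a simple polygonal arc. -/
structure IsPolyPath (n : ℕ) (p : ℕ → Plane) : Prop where
  pos : 0 < n
  ne : ∀ i, i < n → p i ≠ p (i + 1)
  inter : ∀ i, i + 1 < n →
    segment ℝ (p i) (p (i + 1)) ∩ segment ℝ (p (i + 1)) (p (i + 2)) = {p (i + 1)}
  disj : ∀ i j, i + 1 < j → j < n →
    Disjoint (segment ℝ (p i) (p (i + 1))) (segment ℝ (p j) (p (j + 1)))

/-- The union of the first `n` segments of the path `p`. -/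
def polyTrace (n : ℕ) (p : ℕ → Plane) : Set Plane := ⋃ i ∈ Set.Iio n, segment ℝ (p i) (p (i + 1))

lemma mem_polyTrace {n : ℕ} {p : ℕ → Plane} {z : Plane} :
    z ∈ polyTrace n p ↔ ∃ i < n, z ∈ segment ℝ (p i) (p (i + 1)) := by
  simp [polyTrace]

lemma isPolygonalArc_iff {x y : Plane} {C : Set Plane} :
    IsPolygonalArc x y C ↔ ∃ n p, IsPolyPath n p ∧ p 0 = x ∧ p n = y ∧ C = polyTrace n p := by
  constructor
  · rintro ⟨n, p, h1, h2, h3, h4, h5, h6, h7⟩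
    exact ⟨n, p, ⟨h1, h4, h5, h6⟩, h2, h3, h7⟩
  · rintro ⟨n, p, ⟨h1, h4, h5, h6⟩, h2, h3, h7⟩
    exact ⟨n, p, h1, h2, h3, h4, h5, h6, h7⟩

namespace IsPolyPath

variable {n : ℕ} {p : ℕ → Plane}

lemma eq_or_eq_of_mem (h : IsPolyPath n p) {i j : ℕ} (hi : i ≤ n) (hj : j < n)
    (hm : p i ∈ segment ℝ (p j) (p (j + 1))) : i = j ∨ i = j + 1 := by
  by_contra! hcon
  obtain ⟨h1, h2⟩ := hcon
  rcases lt_or_gt_of_ne h1 with h3 | h3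
  · have hl := left_mem_segment ℝ (p i) (p (i + 1))
    rcases (Nat.succ_le_of_lt h3).lt_or_eq with h4 | h4
    · exact (h.disj i j h4 hj).le_bot ⟨hl, hm⟩
    · subst h4
      have : p i ∈ ({p (i + 1)} : Set Plane) := h.inter i hj ▸ ⟨hl, hm⟩
      exact h.ne i (by omega) this
  · obtain ⟨k, rfl⟩ : ∃ k, i = k + 1 := ⟨i - 1, by omega⟩
    have hr := right_mem_segment ℝ (p k) (p (k + 1))
    rcases lt_or_eq_of_le (show j + 1 ≤ k by omega) with h4 | h4
    · exact (h.disj j k h4 (by omega)).le_bot ⟨hm, hr⟩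
    · subst h4
      have : p (j + 1 + 1) ∈ ({p (j + 1)} : Set Plane) := h.inter j (by omega) ▸ ⟨hm, hr⟩
      exact h.ne (j + 1) (by omega) (by simpa using this.symm)

lemma injOn (h : IsPolyPath n p) {i j : ℕ} (hi : i ≤ n) (hj : j ≤ n) (hij : p i = p j) : i = j := by
  wlog hlt : i < j generalizing i j
  · rcases (not_lt.1 hlt).lt_or_eq with h' | h'
    · exact (this hj hi hij.symm h').symm
    · exact h'.symm
  rcases h.eq_or_eq_of_mem hj (by omega : i < n) (hij ▸ left_mem_segment ..) with h1 | h1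
  · exact h1.symm
  · subst h1
    exact absurd hij (h.ne i (by omega))

lemma eq_of_mem_of_mem (h : IsPolyPath n p) {i j : ℕ} (hij : i < j) (hj : j < n) {z : Plane}
    (hi' : z ∈ segment ℝ (p i) (p (i + 1))) (hj' : z ∈ segment ℝ (p j) (p (j + 1))) :
    j = i + 1 ∧ z = p (i + 1) := by
  rcases (Nat.succ_le_of_lt hij).lt_or_eq with h4 | h4
  · exact absurd hj' (Set.disjoint_left.1 (h.disj i j h4 hj) hi')
  · subst h4
    have : z ∈ ({p (i + 1)} : Set Plane) := h.inter i hj ▸ ⟨hi', hj'⟩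
    exact ⟨rfl, this⟩

end IsPolyPath

/-! ### The number of edges of a bipartite plane graph -/

namespace SimpleGraph

/-- A set of edges of a bipartite graph without loose ends has at least four elements. -/
lemma four_le_card_of_no_loose_end {V : Type u} {G : SimpleGraph V} {A B : Set V}
    (hAB : Disjoint A B) (hG : ∀ x y, G.Adj x y → x ∈ A ∧ y ∈ B ∨ x ∈ B ∧ y ∈ A)
    {J : Finset G.edgeSet} (hJ : J.Nonempty)
    (h : ∀ e ∈ J, ∀ w ∈ e.1, ∃ f ∈ J, f ≠ e ∧ w ∈ f.1) : 4 ≤ J.card := by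
  classical
  have hd : ∀ x, x ∈ A → x ∉ B := fun x hx => Set.disjoint_left.1 hAB hx
  have hout : ∀ (f : G.edgeSet) (w : V), w ∈ f.1 → ∃ w', f.1 = s(w, w') ∧ G.Adj w w' := by
    rintro ⟨f, hf⟩ w hw
    obtain ⟨w', rfl⟩ := Sym2.mem_iff_exists.1 hw
    exact ⟨w', rfl, hf⟩
  have hE : ∀ f : G.edgeSet, ∃ a ∈ A, ∃ b ∈ B, f.1 = s(a, b) := by
    rintro ⟨f, hf⟩
    induction f using Sym2.ind with
    | _ x y =>
      rcases hG x y hf with ⟨h1, h2⟩ | ⟨h1, h2⟩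
      · exact ⟨x, h1, y, h2, rfl⟩
      · exact ⟨y, h2, x, h1, Sym2.eq_swap⟩
  obtain ⟨e, he⟩ := hJ
  obtain ⟨a, ha, b, hb, hab⟩ := hE e
  obtain ⟨f, hf, hfe, haf⟩ := h e he a (by simp [hab])
  obtain ⟨g, hg, hge, hbg⟩ := h e he b (by simp [hab])
  obtain ⟨b', hb'f, hb'⟩ := hout f a haf
  obtain ⟨a', ha'g, ha'⟩ := hout g b hbg
  obtain ⟨k, hk, hkf, hbk⟩ := h f hf b' (by simp [hb'f])
  obtain ⟨a₂, ha₂k, ha₂⟩ := hout k b' hbk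
  have hb'B : b' ∈ B := ((hG _ _ hb').resolve_right fun h => hd _ ha h.1).2
  have ha'A : a' ∈ A := ((hG _ _ ha').resolve_left fun h => hd _ h.1 hb).2
  have ha₂A : a₂ ∈ A := ((hG _ _ ha₂).resolve_left fun h => hd _ h.1 hb'B).2
  have n1 : ∀ x ∈ A, ∀ y ∈ B, x ≠ y := fun x hx y hy hxy => hd x hx (hxy ▸ hy)
  have nb : b' ≠ b := by rintro rfl; exact hfe (Subtype.ext (hb'f.trans hab.symm))
  have na : a' ≠ a := by
    rintro rfl; exact hge (Subtype.ext (ha'g.trans (Sym2.eq_swap.trans hab.symm)))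
  have na₂ : a₂ ≠ a := by
    rintro rfl; exact hkf (Subtype.ext (ha₂k.trans (Sym2.eq_swap.trans hb'f.symm)))
  have hag : a ∉ g.1 := by
    rw [ha'g, Sym2.mem_iff]
    rintro (h | h)
    · exact n1 _ ha _ hb h
    · exact na h.symm
  have hak : a ∉ k.1 := by
    rw [ha₂k, Sym2.mem_iff]
    rintro (h | h)
    · exact n1 _ ha _ hb'B h
    · exact na₂ h.symm
  have hbk' : b ∉ k.1 := by
    rw [ha₂k, Sym2.mem_iff]
    rintro (h | h)
    · exact nb h.symm
    · exact n1 _ ha₂A _ hb h.symm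
  have hae : a ∈ e.1 := by simp [hab]
  have hfg : f ≠ g := fun h => hag (h ▸ haf)
  have hek : e ≠ k := fun h => hak (h ▸ hae)
  have hgk : g ≠ k := fun h => hbk' (h ▸ hbg)
  calc 4 = ({e, f, g, k} : Finset G.edgeSet).card := by
        rw [Finset.card_eq_of_equiv_fin]
        exact (Finset.equivFinOfCardEq (by
          rw [Finset.card_insert_of_notMem, Finset.card_insert_of_notMem,
            Finset.card_insert_of_notMem, Finset.card_singleton]
          · simpa using hgk
          · simpa using ⟨hfg, hkf.symm⟩
          · simpa using ⟨hfe.symm, hge.symm, hek⟩))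
    _ ≤ J.card := Finset.card_le_card (by
        intro x hx
        simp only [Finset.mem_insert, Finset.mem_singleton] at hx
        rcases hx with rfl | rfl | rfl | rfl <;> assumption)

namespace PlaneDrawing

variable {V : Type u} {G : SimpleGraph V} (D : G.PlaneDrawing)

lemma exists_polyPath (e : G.edgeSet) : ∃ (x y : V) (n : ℕ) (p : ℕ → Plane),
    e.1 = s(x, y) ∧ IsPolyPath n p ∧ p 0 = D.pos x ∧ p n = D.pos y ∧
      D.curve e.1 = polyTrace n p := by
  obtain ⟨e, he⟩ := e
  induction e using Sym2.ind with
  | _ x y =>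
    obtain ⟨n, p, h⟩ := isPolygonalArc_iff.1 (D.isPolygonalArc x y he)
    exact ⟨x, y, n, p, rfl, h⟩

/-- The first end of an edge, in the direction in which its arc is parametrized. -/
noncomputable def fst (e : G.edgeSet) : V := (D.exists_polyPath e).choose

/-- The last end of an edge, in the direction in which its arc is parametrized. -/
noncomputable def lst (e : G.edgeSet) : V := (D.exists_polyPath e).choose_spec.choose

/-- The number of segments of the arc of an edge. -/
noncomputable def len (e : G.edgeSet) : ℕ :=
  (D.exists_polyPath e).choose_spec.choose_spec.choose

/-- The corners of the arc of an edge. -/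
noncomputable def corner (e : G.edgeSet) : ℕ → Plane :=
  (D.exists_polyPath e).choose_spec.choose_spec.choose_spec.choose

lemma corner_spec (e : G.edgeSet) :
    e.1 = s(D.fst e, D.lst e) ∧ IsPolyPath (D.len e) (D.corner e) ∧
      D.corner e 0 = D.pos (D.fst e) ∧ D.corner e (D.len e) = D.pos (D.lst e) ∧
      D.curve e.1 = polyTrace (D.len e) (D.corner e) :=
  (D.exists_polyPath e).choose_spec.choose_spec.choose_spec.choose_spec

lemma isPolyPath (e : G.edgeSet) : IsPolyPath (D.len e) (D.corner e) := (D.corner_spec e).2.1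

lemma mem_curve (e : G.edgeSet) {k : ℕ} (hk : k < D.len e) {z : Plane}
    (hz : z ∈ segment ℝ (D.corner e k) (D.corner e (k + 1))) : z ∈ D.curve e.1 := by
  rw [(D.corner_spec e).2.2.2.2]
  exact mem_polyTrace.2 ⟨k, hk, hz⟩

/-- The end vertices of an edge are the extreme corners of its arc. -/
lemma pos_eq_corner (e : G.edgeSet) {w : V} (hw : w ∈ e.1) :
    D.pos w = D.corner e 0 ∨ D.pos w = D.corner e (D.len e) := by
  obtain ⟨h1, -, h3, h4, -⟩ := D.corner_spec e
  rw [h1, Sym2.mem_iff] at hw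
  rcases hw with rfl | rfl
  · exact Or.inl h3.symm
  · exact Or.inr h4.symm

lemma exists_eq_pos {e f : G.edgeSet} (hef : e ≠ f) {z : Plane} (he : z ∈ D.curve e.1)
    (hf : z ∈ D.curve f.1) : ∃ w, w ∈ e.1 ∧ w ∈ f.1 ∧ z = D.pos w :=
  D.eq_pos_of_mem e.1 e.2 f.1 f.2 (fun h => hef (Subtype.ext h)) z ⟨he, hf⟩

lemma pos_eq_of_mem_segment (e : G.edgeSet) {w : V} (hw : w ∈ e.1) {k : ℕ} (hk : k < D.len e)
    (hz : D.pos w ∈ segment ℝ (D.corner e k) (D.corner e (k + 1))) :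
    D.pos w = D.corner e k ∨ D.pos w = D.corner e (k + 1) := by
  rcases D.pos_eq_corner e hw with h | h
  all_goals
    rw [h] at hz ⊢
    rcases (D.isPolyPath e).eq_or_eq_of_mem (by omega) hk hz with h' | h' <;> rw [h'] <;> simp

/-- The straight segments of which the arcs of a drawing consist. -/
noncomputable def segSystem : SegSystem (Σ e : G.edgeSet, Fin (D.len e)) where
  a i := D.corner i.1 i.2
  b i := D.corner i.1 (i.2 + 1)
  ne i := (D.isPolyPath i.1).ne _ i.2.2
  meet := by
    rintro ⟨e, k⟩ ⟨f, l⟩ hne z hz hz'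
    by_cases hef : e = f
    · subst hef
      have hkl : (k : ℕ) ≠ l := fun h => hne (by rw [Fin.ext h])
      rcases hkl.lt_or_gt with h | h
      · obtain ⟨h1, h2⟩ := (D.isPolyPath e).eq_of_mem_of_mem h l.2 hz hz'
        simp [h1, h2]
      · obtain ⟨h1, h2⟩ := (D.isPolyPath e).eq_of_mem_of_mem h k.2 hz' hz
        simp [h1, h2]
    · obtain ⟨w, h1, h2, rfl⟩ := D.exists_eq_pos hef (D.mem_curve e k.2 hz) (D.mem_curve f l.2 hz')
      exact ⟨D.pos_eq_of_mem_segment e h1 k.2 hz, D.pos_eq_of_mem_segment f h2 l.2 hz'⟩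

/-- The end points of the segments are vertices or inner corners of arcs. -/
lemma ends_subset :
    D.segSystem.ends ⊆ D.pos '' {w | ∃ e ∈ G.edgeSet, w ∈ e} ∪
      range fun i : Σ e : G.edgeSet, Fin (D.len e - 1) => D.corner i.1 (i.2 + 1) := by
  have key : ∀ (e : G.edgeSet) (k : ℕ), k ≤ D.len e →
      D.corner e k ∈ D.pos '' {w | ∃ e ∈ G.edgeSet, w ∈ e} ∪
        range fun i : Σ e : G.edgeSet, Fin (D.len e - 1) => D.corner i.1 (i.2 + 1) := by
    intro e k hk
    obtain ⟨h1, -, h3, h4, -⟩ := D.corner_spec e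
    rcases Nat.eq_zero_or_pos k with rfl | h0
    · exact Or.inl ⟨_, ⟨e.1, e.2, by rw [h1]; simp⟩, h3.symm⟩
    rcases hk.lt_or_eq with hk | rfl
    · refine Or.inr ⟨⟨e, ⟨k - 1, by omega⟩⟩, ?_⟩
      simp only
      congr 1; omega
    · refine Or.inl ⟨_, ⟨e.1, e.2, (congrArg (_ ∈ ·) h1).mpr (by simp)⟩, h4.symm⟩
  rintro _ (⟨⟨e, k⟩, rfl⟩ | ⟨⟨e, k⟩, rfl⟩)
  · exact key e k k.2.le
  · exact key e (k + 1) k.2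

variable {D}

lemma eq_of_isEnd_corner {e f : G.edgeSet} {k : ℕ} (hk : k ≤ D.len e) {l : Fin (D.len f)}
    (h : D.segSystem.IsEnd (D.corner e k) ⟨f, l⟩) (hef : f = e) : k = l ∨ k = l + 1 := by
  subst hef
  rcases h with h | h
  · exact Or.inl ((D.isPolyPath f).injOn hk l.2.le h)
  · exact Or.inr ((D.isPolyPath f).injOn hk l.2 h)

lemma mem_curve_of_isEnd {f : G.edgeSet} {l : Fin (D.len f)} {q : Plane}
    (h : D.segSystem.IsEnd q ⟨f, l⟩) : q ∈ D.curve f.1 := by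
  rcases h with rfl | rfl
  · exact D.mem_curve f l.2 (left_mem_segment ..)
  · exact D.mem_curve f l.2 (right_mem_segment ..)

/-- At an inner corner of an arc only two segments meet. -/
lemma eq_of_isEnd_inner_corner {e f : G.edgeSet} {k : ℕ} (h0 : 0 < k) (hk : k < D.len e)
    {l : Fin (D.len f)} (h : D.segSystem.IsEnd (D.corner e k) ⟨f, l⟩) : f = e := by
  by_contra hef
  obtain ⟨w, h1, -, h3⟩ := D.exists_eq_pos (Ne.symm hef)
    (D.mem_curve e hk (left_mem_segment ..)) (mem_curve_of_isEnd h)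
  rcases D.pos_eq_corner e h1 with h4 | h4
  · exact h0.ne' ((D.isPolyPath e).injOn hk.le (Nat.zero_le _) (h3.trans h4))
  · exact hk.ne ((D.isPolyPath e).injOn hk.le le_rfl (h3.trans h4))

variable [Fintype G.edgeSet] {α : D.segSystem.Cyc → ZMod 2}

/-- An arc one of whose segments bounds a face has all its segments on the boundary. -/
lemma jumps_of_jumps {e : G.edgeSet} {k : ℕ} (hk : k + 1 < D.len e) :
    D.segSystem.Jumps α ⟨e, ⟨k, by omega⟩⟩ ↔ D.segSystem.Jumps α ⟨e, ⟨k + 1, hk⟩⟩ := by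
  constructor
  · intro h
    obtain ⟨⟨f, l⟩, h1, h2, h3⟩ := SegSystem.exists_jumps_ne (q := D.corner e (k + 1))
      (Or.inr rfl) h
    obtain rfl := eq_of_isEnd_inner_corner (by omega) hk h2
    rcases eq_of_isEnd_corner hk.le h2 rfl with h4 | h4
    · have : l = ⟨k + 1, hk⟩ := Fin.ext h4.symm
      rwa [this] at h3
    · exact absurd (by congr 1; exact Fin.ext (by simpa using h4.symm)) h1
  · intro h
    obtain ⟨⟨f, l⟩, h1, h2, h3⟩ := SegSystem.exists_jumps_ne (q := D.corner e (k + 1))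
      (Or.inl rfl) h
    obtain rfl := eq_of_isEnd_inner_corner (by omega) hk h2
    rcases eq_of_isEnd_corner hk.le h2 rfl with h4 | h4
    · exact absurd (by congr 1; exact Fin.ext h4.symm) h1
    · have : l = ⟨k, by omega⟩ := Fin.ext (by simpa using h4.symm)
      rwa [this] at h3

lemma jumps_iff {e : G.edgeSet} (k l : Fin (D.len e)) :
    D.segSystem.Jumps α ⟨e, k⟩ ↔ D.segSystem.Jumps α ⟨e, l⟩ := by
  have key : ∀ k (hk : k < D.len e), D.segSystem.Jumps α ⟨e, ⟨k, hk⟩⟩ ↔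
      D.segSystem.Jumps α ⟨e, ⟨0, (D.isPolyPath e).pos⟩⟩ := by
    intro k
    induction k with
    | zero => intro _; rfl
    | succ k ih => intro hk; rw [← jumps_of_jumps hk, ih]
  rw [key k.1 k.2, key l.1 l.2]

lemma exists_jumps_ne_edge {e : G.edgeSet} {k : Fin (D.len e)} (h : D.segSystem.Jumps α ⟨e, k⟩)
    {w : V} (hw : w ∈ e.1) :
    ∃ f : G.edgeSet, (∃ l, D.segSystem.Jumps α ⟨f, l⟩) ∧ f ≠ e ∧ w ∈ f.1 := by
  obtain ⟨m, hm, l, hl, hlm⟩ : ∃ m, D.pos w = D.corner e m ∧ ∃ l : Fin (D.len e),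
      D.segSystem.IsEnd (D.pos w) ⟨e, l⟩ ∧ m ≤ D.len e ∧
        ∀ l' : Fin (D.len e), (m = l' ∨ m = l' + 1) → l' = l := by
    have h0 := (D.isPolyPath e).pos
    rcases D.pos_eq_corner e hw with h | h
    · exact ⟨0, h, ⟨0, h0⟩, Or.inl h, Nat.zero_le _, fun l' h => Fin.ext (by simp; omega)⟩
    · refine ⟨D.len e, h, ⟨D.len e - 1, by omega⟩, Or.inr ?_, le_rfl,
        fun l' h => Fin.ext (by have := l'.2; simp; omega)⟩
      rw [h]
      simp only [segSystem]
      congr 1; omega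
  obtain ⟨⟨f, l'⟩, h1, h2, h3⟩ := SegSystem.exists_jumps_ne hl ((jumps_iff k l).1 h)
  refine ⟨f, ⟨l', h3⟩, ?_, D.mem_of_pos_mem f.1 f.2 w (mem_curve_of_isEnd h2)⟩
  rintro rfl
  rw [hm] at h2
  exact h1 (by rw [hlm.2 l' (eq_of_isEnd_corner hlm.1 h2 rfl)])

/-- The number of edges of a bipartite plane graph. The second alternative is the case of a single
face. -/
theorem card_edges_bipartite [Finite V] (D : G.PlaneDrawing) {A B : Set V} (hAB : Disjoint A B)
    (hG : ∀ x y, G.Adj x y → x ∈ A ∧ y ∈ B ∨ x ∈ B ∧ y ∈ A) :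
    Fintype.card G.edgeSet + 2 ≤ 2 * (A.ncard + B.ncard) ∨
      Fintype.card G.edgeSet ≤ A.ncard + B.ncard := by
  classical
  set S := D.segSystem with hS
  set N := S.faces.ncard with hN
  -- Each arc has one inner corner less than it has segments.
  have hends : S.ends.ncard ≤ A.ncard + B.ncard + ∑ e : G.edgeSet, (D.len e - 1) := by
    calc S.ends.ncard ≤ _ := Set.ncard_le_ncard D.ends_subset (Set.toFinite _)
      _ ≤ _ := Set.ncard_union_le _ _
      _ ≤ _ := by
        refine add_le_add ?_ ?_
        · refine (Set.ncard_image_le (Set.toFinite _)).trans ?_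
          refine (Set.ncard_le_ncard ?_ (Set.toFinite (A ∪ B))).trans (Set.ncard_union_le _ _)
          rintro w ⟨e, he, hw⟩
          obtain ⟨w', rfl⟩ := Sym2.mem_iff_exists.1 hw
          rcases hG w w' he with h | h
          · exact Or.inl h.1
          · exact Or.inr h.1
        · rw [← Set.image_univ]
          refine (Set.ncard_image_le (Set.toFinite _)).trans ?_
          rw [Set.ncard_univ, Nat.card_eq_fintype_card, Fintype.card_sigma]
          simp
  have hI := S.card_add_one_le
  rw [Fintype.card_sigma] at hI
  simp only [Fintype.card_fin] at hI
  have hsum : ∑ e : G.edgeSet, D.len e =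
      ∑ e : G.edgeSet, (D.len e - 1) + Fintype.card G.edgeSet := by
    rw [← Finset.card_univ, Finset.card_eq_sum_ones, ← Finset.sum_add_distrib]
    refine Finset.sum_congr rfl fun e _ => ?_
    have := (D.isPolyPath e).pos
    omega
  have hE : Fintype.card G.edgeSet + 1 ≤ N + A.ncard + B.ncard := by omega
  rcases Nat.lt_or_ge N 2 with h2 | h2
  · right; omega
  left
  -- Each face is bounded by at least four edges and each edge bounds at most two faces.
  have hcount : S.faces.toFinite.toFinset.card * 4 ≤ (Finset.univ : Finset G.edgeSet).card * 2 := by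
    refine Finset.card_mul_le_card_mul
      (fun α (e : G.edgeSet) => ∃ k, S.Jumps α ⟨e, k⟩) ?_ ?_
    · intro α hα
      rw [Set.Finite.mem_toFinset] at hα
      obtain ⟨β, hβ, hne⟩ := Set.exists_ne_of_one_lt_ncard (by omega : 1 < S.faces.ncard) α
      obtain ⟨⟨e, k⟩, hk⟩ := SegSystem.exists_jumps hα hβ hne.symm
      refine four_le_card_of_no_loose_end hAB hG ⟨e, ?_⟩ ?_
      · simpa [Finset.mem_bipartiteAbove] using ⟨k, hk⟩
      · intro e he w hw
        rw [Finset.mem_bipartiteAbove] at he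
        obtain ⟨-, k, hk⟩ := he
        obtain ⟨f, h1, h2, h3⟩ := exists_jumps_ne_edge hk hw
        exact ⟨f, by simpa [Finset.mem_bipartiteAbove] using h1, h2, h3⟩
    · intro e _
      let i : Σ e : G.edgeSet, Fin (D.len e) := ⟨e, ⟨0, (D.isPolyPath e).pos⟩⟩
      refine (Finset.card_le_card (t := {S.leftLabel i, S.rightLabel i}) ?_).trans
        Finset.card_le_two
      intro α hα
      rw [Finset.mem_bipartiteBelow] at hα
      obtain ⟨-, k, hk⟩ := hα
      have hj : S.Jumps α i := (jumps_iff k _).1 hk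
      rw [Finset.mem_insert, Finset.mem_singleton]
      by_contra hcon
      push Not at hcon
      exact hj (iff_of_false hcon.1.symm hcon.2.symm)
  rw [← Set.ncard_eq_toFinset_card, Finset.card_univ] at hcount
  omega

end PlaneDrawing

end SimpleGraph

/-! ### Vertices with three neighbours in a set -/

namespace SimpleGraph

variable {V : Type u} {W : Type v} {G : SimpleGraph V} {H : SimpleGraph W}

/-- A drawing of a graph contains drawings of the graphs that embed in it. -/
def PlaneDrawing.comap (D : G.PlaneDrawing) (f : W → V) (hf : Function.Injective f)
    (h : ∀ x y, H.Adj x y → G.Adj (f x) (f y)) : H.PlaneDrawing where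
  pos := D.pos ∘ f
  curve e := D.curve (e.map f)
  pos_injective := D.pos_injective.comp hf
  isPolygonalArc a b hab := D.isPolygonalArc _ _ (h a b hab)
  mem_of_pos_mem := by
    intro e he w hw
    have he' : e.map f ∈ G.edgeSet := by
      induction e using Sym2.ind with
      | _ x y => exact h x y he
    obtain ⟨w', h1, h2⟩ := Sym2.mem_map.1 (D.mem_of_pos_mem _ he' _ hw)
    exact hf h2 ▸ h1
  eq_pos_of_mem := by
    intro e he g hg hne z hz
    have key : ∀ e ∈ H.edgeSet, e.map f ∈ G.edgeSet := by
      intro e he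
      induction e using Sym2.ind with
      | _ x y => exact h x y he
    obtain ⟨w, h1, h2, h3⟩ := D.eq_pos_of_mem _ (key e he) _ (key g hg)
      (fun h => hne (Sym2.map.injective hf h)) z hz
    obtain ⟨x, hx, rfl⟩ := Sym2.mem_map.1 h1
    obtain ⟨y, hy, hxy⟩ := Sym2.mem_map.1 h2
    exact ⟨x, hx, hf hxy ▸ hy, h3⟩

lemma IsPlanar.of_embedding (hG : G.IsPlanar) (f : W → V) (hf : Function.Injective f)
    (h : ∀ x y, H.Adj x y → G.Adj (f x) (f y)) : H.IsPlanar :=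
  hG.map fun D => D.comap f hf h

lemma three_mul_card_threeAttached_le [Finite V] (B : Set V) :
    3 * (G.threeAttached B).ncard ≤ G.edgesBetween (G.threeAttached B) B := by
  classical
  have := Fintype.ofFinite V
  set A := G.threeAttached B
  rw [edgesBetween, Set.ncard_eq_toFinset_card', Set.ncard_eq_toFinset_card',
    Finset.card_eq_sum_card_fiberwise (f := Prod.fst) (t := A.toFinset), mul_comm, ← smul_eq_mul]
  · refine Finset.card_nsmul_le_sum _ _ _ fun a ha => ?_
    rw [Set.mem_toFinset] at ha
    refine ha.2.trans ?_
    rw [Set.ncard_eq_toFinset_card']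
    refine Finset.card_le_card_of_injOn (fun b => (a, b)) ?_ ?_
    · intro b hb
      have hb' : G.Adj a b ∧ b ∈ B := by simpa using hb
      simp [hb'.1, hb'.2, ha]
    · intro b _ c _ h
      exact (Prod.ext_iff.1 h).2
  · intro p hp
    have : p.1 ∈ A ∧ p.2 ∈ B ∧ G.Adj p.1 p.2 := by simpa using hp
    simpa using this.1

theorem IsPlanar.edgesBetween_lt [Finite V] (hG : G.IsPlanar) {B : Set V} (hB : B.Nonempty) :
    G.edgesBetween (G.threeAttached B) B < 6 * B.ncard := by
  classical
  set A := G.threeAttached B with hA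
  have hAB : Disjoint A B := Set.disjoint_left.2 fun x hx => hx.1
  have hd : ∀ x, x ∈ A → x ∉ B := fun x hx => hx.1
  -- The bipartite graph of the edges between `A` and `B`.
  let K : SimpleGraph V :=
    { Adj := fun x y => G.Adj x y ∧ (x ∈ A ∧ y ∈ B ∨ x ∈ B ∧ y ∈ A)
      symm := ⟨fun x y h => ⟨h.1.symm, by tauto⟩⟩
      loopless := ⟨fun x h => h.1.ne rfl⟩ }
  obtain ⟨D⟩ := hG.of_embedding (H := K) id Function.injective_id fun x y h => h.1
  have := Fintype.ofFinite V
  have hle : G.edgesBetween A B ≤ Fintype.card K.edgeSet := by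
    rw [edgesBetween, ← Nat.card_eq_fintype_card, Nat.card_coe_set_eq]
    refine Set.ncard_le_ncard_of_injOn (fun p => s(p.1, p.2)) ?_ ?_ (Set.toFinite _)
    · rintro ⟨x, y⟩ ⟨h1, h2, h3⟩
      exact ⟨h3, Or.inl ⟨h1, h2⟩⟩
    · rintro ⟨x, y⟩ ⟨h1, h2, h3⟩ ⟨x', y'⟩ ⟨h1', h2', h3'⟩ h
      rcases Sym2.eq_iff.1 h with ⟨rfl, rfl⟩ | ⟨h4, h5⟩
      · rfl
      · exact absurd h2' (hd _ (h4 ▸ h1))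
  have h3 := three_mul_card_threeAttached_le (G := G) B
  have hpos : 0 < B.ncard := (Set.ncard_pos (Set.toFinite _)).2 hB
  rw [← hA] at h3
  rcases D.card_edges_bipartite hAB fun x y h => h.2 with h | h <;> omega

end SimpleGraph

/-! ### Rerouting arcs along a segment -/

namespace Plane

/-- The excess of the path from `c` to `x` through `z` over the straight one. Its sublevel sets are
ellipses with foci `c` and `x`, which serve as convex neighbourhoods of the segment `cx`. -/
noncomputable def excess (c x z : Plane) : ℝ := dist z c + dist z x - dist c x

variable {c x : Plane}

lemma continuous_excess (c x : Plane) : Continuous (excess c x) := by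
  unfold excess; fun_prop

lemma excess_nonneg (c x z : Plane) : 0 ≤ excess c x z := by
  have := dist_triangle_left c x z
  unfold excess; linarith

lemma excess_eq_zero_iff {z : Plane} : excess c x z = 0 ↔ z ∈ segment ℝ c x := by
  rw [mem_segment_iff_wbtw, ← dist_add_dist_eq_iff, excess, sub_eq_zero, dist_comm z c]

lemma excess_pos {z : Plane} (h : z ∉ segment ℝ c x) : 0 < excess c x z :=
  lt_of_le_of_ne (excess_nonneg c x z) fun h' => h (excess_eq_zero_iff.1 h'.symm)

lemma excess_left : excess c x c = 0 := excess_eq_zero_iff.2 (left_mem_segment ..)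

lemma excess_right : excess c x x = 0 := excess_eq_zero_iff.2 (right_mem_segment ..)

lemma excess_lineMap_le (a b : Plane) {t : ℝ} (h0 : 0 ≤ t) (h1 : t ≤ 1) :
    excess c x (AffineMap.lineMap a b t) ≤ (1 - t) * excess c x a + t * excess c x b := by
  have e : AffineMap.lineMap a b t = (1 - t) • a + t • b := AffineMap.lineMap_apply_module a b t
  have hc := (convexOn_dist c convex_univ).2 (mem_univ a) (mem_univ b) (sub_nonneg.2 h1) h0
    (by ring)
  have hx := (convexOn_dist x convex_univ).2 (mem_univ a) (mem_univ b) (sub_nonneg.2 h1) h0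
    (by ring)
  simp only [smul_eq_mul] at hc hx
  rw [e]
  unfold excess
  linarith

/-- Compact sets that miss the segment `cx` miss a thin ellipse around it. -/
lemma exists_lt_excess {K : Set Plane} (hK : IsCompact K) (h : Disjoint K (segment ℝ c x)) :
    ∃ ε : ℝ, 0 < ε ∧ ∀ z ∈ K, ε < excess c x z := by
  rcases K.eq_empty_or_nonempty with rfl | hne
  · exact ⟨1, one_pos, by simp⟩
  · obtain ⟨z, hz, hm⟩ := hK.exists_isMinOn hne (continuous_excess c x).continuousOn
    have := excess_pos (Set.disjoint_left.1 h hz)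
    refine ⟨excess c x z / 2, by linarith, fun w hw => ?_⟩
    have := isMinOn_iff.1 hm w hw
    linarith

/-- Two segments that start at `c` and meet elsewhere lie on one ray. -/
lemma mem_segment_or_mem_segment {q d z : Plane} (hq : z ∈ segment ℝ c q)
    (hd : z ∈ segment ℝ c d) (hz : z ≠ c) : q ∈ segment ℝ c d ∨ d ∈ segment ℝ c q := by
  obtain ⟨s, s0, s1, hs⟩ := mem_segment_iff.1 hq
  obtain ⟨t, t0, t1, ht⟩ := mem_segment_iff.1 hd
  have s0' : 0 < s := s0.lt_of_ne fun h => hz (by rw [← hs, ← h]; simp)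
  have t0' : 0 < t := t0.lt_of_ne fun h => hz (by rw [← ht, ← h]; simp)
  have hst : ∀ i : Fin 2, s * (q i - c i) = t * (d i - c i) := by
    intro i
    have h1 := congrArg (fun w : Plane => w i) (hs.trans ht.symm)
    simp only [lineMap_coord] at h1
    linarith
  rcases le_total t s with h | h
  · left
    refine mem_segment_iff.2 ⟨t / s, by positivity, (div_le_one s0').2 h, ?_⟩
    apply ext_coord <;>
      rw [lineMap_coord, div_mul_eq_mul_div, ← hst, mul_div_cancel_left₀ _ s0'.ne'] <;> ring
  · right
    refine mem_segment_iff.2 ⟨s / t, by positivity, (div_le_one t0').2 h, ?_⟩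
    apply ext_coord <;>
      rw [lineMap_coord, div_mul_eq_mul_div, hst, mul_div_cancel_left₀ _ t0'.ne'] <;> ring

lemma excess_lt_of_mem {q z : Plane} {ε : ℝ} (hε : 0 < ε) (hq : excess c x q = ε)
    (hz : z ∈ segment ℝ c q) (hne : z ≠ q) : excess c x z < ε := by
  obtain ⟨s, s0, s1, rfl⟩ := mem_segment_iff.1 hz
  have hs : s < 1 := s1.lt_of_ne fun h => hne (by rw [h]; simp)
  have := excess_lineMap_le (c := c) (x := x) c q s0 s1
  rw [excess_left, hq] at this
  nlinarith

lemma excess_le_of_mem {q z : Plane} {ε : ℝ} (hε : 0 < ε) (hq : excess c x q = ε)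
    (hz : z ∈ segment ℝ c q) : excess c x z ≤ ε := by
  by_cases h : z = q
  · rw [h, hq]
  · exact (excess_lt_of_mem hε hq hz h).le

/-- The place where a segment from `x` leaves an ellipse around `cx`. -/
lemma exists_exit {r : Plane} {ε : ℝ} (hε : 0 < ε) (hr : ε < excess c x r) :
    ∃ q ∈ segment ℝ x r, excess c x q = ε ∧ ∀ z ∈ segment ℝ q r, ε ≤ excess c x z := by
  have hc : Continuous fun t : ℝ => excess c x (AffineMap.lineMap x r t) :=
    (continuous_excess c x).comp AffineMap.lineMap_continuous
  obtain ⟨t, ⟨t0, t1⟩, ht⟩ := intermediate_value_Icc zero_le_one hc.continuousOn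
    (show ε ∈ Icc _ _ by simpa [excess_right] using ⟨hε.le, hr.le⟩)
  refine ⟨_, mem_segment_iff.2 ⟨t, t0, t1, rfl⟩, ht, fun z hz => ?_⟩
  obtain ⟨s, s0, s1, rfl⟩ := mem_segment_iff.1 hz
  simp only at ht
  have t0' : 0 < t := t0.lt_of_ne fun h => hε.ne (by rw [← ht, ← h]; simp [excess_right])
  have hu : 0 < t + s * (1 - t) := by nlinarith
  have e1 : AffineMap.lineMap (AffineMap.lineMap x r t) r s =
      AffineMap.lineMap x r (t + s * (1 - t)) := by
    apply ext_coord <;> simp only [lineMap_coord] <;> ring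
  have e2 : AffineMap.lineMap x (AffineMap.lineMap x r (t + s * (1 - t)))
      (t / (t + s * (1 - t))) = AffineMap.lineMap x r t := by
    apply ext_coord <;> simp only [lineMap_coord] <;> field_simp <;> ring
  rw [e1]
  set z := AffineMap.lineMap x r (t + s * (1 - t)) with hz'
  have hle : t / (t + s * (1 - t)) ≤ 1 := (div_le_one hu).2 (by nlinarith)
  have := excess_lineMap_le (c := c) (x := x) x z (by positivity) hle
  rw [e2, ht, excess_right, mul_zero, zero_add] at this
  exact this.trans (mul_le_of_le_one_left (excess_nonneg _ _ _) hle)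

end Plane

open Plane

lemma isCompact_polyTrace (n : ℕ) (p : ℕ → Plane) : IsCompact (polyTrace n p) :=
  (Set.finite_Iio n).isCompact_biUnion fun _ _ => isCompact_segment _ _

/-- A path from `x` is led to `c` instead: it is cut where it leaves a thin ellipse with foci `c`
and `x`, at `q`, and `q` is joined to `c` by a segment. -/
lemma IsPolyPath.exists_reroute {n : ℕ} {p : ℕ → Plane} (h : IsPolyPath n p) {c : Plane} {ε : ℝ}
    (hε : 0 < ε) (h1 : ε < excess c (p 0) (p 1))
    (ht : ∀ i, 1 ≤ i → i < n → ∀ z ∈ segment ℝ (p i) (p (i + 1)), ε < excess c (p 0) z) :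
    ∃ q ∈ polyTrace n p, excess c (p 0) q = ε ∧ ∃ C, IsPolygonalArc c (p n) C ∧
      ∀ z ∈ C, excess c (p 0) z < ε ∧ z ∈ segment ℝ c q ∨
        ε ≤ excess c (p 0) z ∧ z ∈ polyTrace n p := by
  obtain ⟨q, hq, hqε, hqr⟩ := exists_exit hε h1
  have hsub : segment ℝ q (p 1) ⊆ segment ℝ (p 0) (p 1) :=
    (convex_segment _ _).segment_subset hq (right_mem_segment ..)
  have hqt : q ∈ polyTrace n p := mem_polyTrace.2 ⟨0, h.pos, hq⟩
  let p' : ℕ → Plane := fun k => match k with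
    | 0 => c
    | 1 => q
    | k + 2 => p (k + 1)
  have hpath : IsPolyPath (n + 1) p' := by
    refine ⟨Nat.succ_pos _, ?_, ?_, ?_⟩
    · rintro (_ | _ | k) hk
      · rintro (rfl : c = q)
        rw [excess_left] at hqε
        exact hε.ne hqε
      · rintro (rfl : q = p 1)
        exact h1.ne' hqε
      · exact h.ne (k + 1) (by omega)
    · rintro (_ | _ | k) hk
      · refine Set.Subset.antisymm ?_ ?_
        · rintro z ⟨hz1, hz2⟩
          by_contra hne
          exact (excess_lt_of_mem hε hqε hz1 hne).not_ge (hqr z hz2)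
        · rintro _ rfl
          exact ⟨right_mem_segment .., left_mem_segment ..⟩
      · refine Set.Subset.antisymm ?_ ?_
        · rintro z ⟨hz1, hz2⟩
          exact h.inter 0 (by omega) ▸ ⟨hsub hz1, hz2⟩
        · rintro _ rfl
          exact ⟨right_mem_segment .., left_mem_segment ..⟩
      · exact h.inter (k + 1) (by omega)
    · rintro (_ | _ | i) (_ | _ | j) hij hj
      any_goals omega
      · refine Set.disjoint_left.2 fun z hz1 hz2 => ?_
        exact (excess_le_of_mem hε hqε hz1).not_gt (ht (j + 1) (by omega) (by omega) z hz2)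
      · exact (h.disj 0 (j + 1) (by omega) (by omega)).mono_left hsub
      · exact h.disj (i + 1) (j + 1) (by omega) (by omega)
  have hend : p' (n + 1) = p n := by
    obtain ⟨m, rfl⟩ : ∃ m, n = m + 1 := ⟨n - 1, by have := h.pos; omega⟩
    rfl
  refine ⟨q, hqt, hqε, polyTrace (n + 1) p', isPolygonalArc_iff.2 ⟨_, _, hpath, rfl, hend, rfl⟩,
    fun z hz => ?_⟩
  obtain ⟨i, hi, hz⟩ := mem_polyTrace.1 hz
  rcases i with _ | _ | k
  · by_cases hzq : z = q
    · subst hzq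
      exact Or.inr ⟨hqε.ge, hqt⟩
    · exact Or.inl ⟨excess_lt_of_mem hε hqε hz hzq, hz⟩
  · exact Or.inr ⟨hqr z hz, mem_polyTrace.2 ⟨0, h.pos, hsub hz⟩⟩
  · exact Or.inr ⟨(ht (k + 1) (by omega) (by omega) z hz).le,
      mem_polyTrace.2 ⟨k + 1, by omega, hz⟩⟩

/-- Close to `c`, the set `F` consists of finitely many straight segments that start at `c`; further
away it is compact. -/
def IsConicAt (c : Plane) (F : Set Plane) : Prop :=
  ∃ F₀ D : Set Plane, IsCompact F₀ ∧ c ∉ F₀ ∧ D.Finite ∧ F = F₀ ∪ ⋃ d ∈ D, segment ℝ c d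

lemma IsConicAt.isCompact {c : Plane} {F : Set Plane} (h : IsConicAt c F) : IsCompact F := by
  obtain ⟨F₀, D, h1, -, h2, rfl⟩ := h
  exact h1.union (h2.isCompact_biUnion fun _ _ => isCompact_segment _ _)

/-- Finitely many arcs from `x` can be led to `c` along the segment `cx`, without new intersections
among them or with the fixed set `F`. -/
theorem exists_reroute_segment {M : Type*} [Finite M] {c x : Plane} {F : Set Plane}
    (hF : IsConicAt c F) (hFs : ∀ z ∈ F, z ∈ segment ℝ c x → z = c)
    {C : M → Set Plane} {y : M → Plane} (hC : ∀ j, IsPolygonalArc x (y j) (C j))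
    (hCs : ∀ j, ∀ z ∈ C j, z ∈ segment ℝ c x → z = x)
    (hCC : ∀ i j, i ≠ j → ∀ z ∈ C i, z ∈ C j → z = x)
    (hCF : ∀ j, ∀ z ∈ C j, z ∈ F → z = y j) :
    ∃ C' : M → Set Plane, (∀ j, IsPolygonalArc c (y j) (C' j)) ∧
      (∀ i j, i ≠ j → ∀ z ∈ C' i, z ∈ C' j → z = c) ∧
      ∀ j, ∀ z ∈ C' j, z ∈ F → z = c ∨ z = y j := by
  obtain ⟨F₀, D, hF₀, hcF₀, hD, rfl⟩ := hF
  choose n p hp hpx hpy hCp using fun j => isPolygonalArc_iff.1 (hC j)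
  -- The obstacles that the ellipse has to avoid.
  let K : Set Plane := F₀ ∪ D \ {c} ∪ ⋃ j, ({p j 1} ∪
    ⋃ i ∈ {i | 1 ≤ i ∧ i < n j}, segment ℝ (p j i) (p j (i + 1)))
  have hK : IsCompact K := by
    refine (hF₀.union (hD.subset sdiff_subset).isCompact).union (isCompact_iUnion fun j => ?_)
    refine isCompact_singleton.union (Set.Finite.isCompact_biUnion ?_ fun _ _ =>
      isCompact_segment _ _)
    exact (Set.finite_Iio (n j)).subset fun i hi => hi.2
  have hKs : Disjoint K (segment ℝ c x) := by
    refine Set.disjoint_left.2 ?_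
    rintro z ((hz | ⟨hz, hzc⟩) | hz) hs
    · exact hcF₀ (hFs z (Or.inl hz) hs ▸ hz)
    · exact hzc (hFs z (Or.inr (mem_biUnion hz (right_mem_segment ..))) hs)
    · obtain ⟨j, hz⟩ := mem_iUnion.1 hz
      have hnot : ∀ i, 1 ≤ i → i < n j → x ∉ segment ℝ (p j i) (p j (i + 1)) := by
        intro i h1 h2 hx
        rcases (hp j).eq_or_eq_of_mem (Nat.zero_le _) h2 (hpx j ▸ hx) with h | h <;> omega
      rcases hz with rfl | hz
      · have := hCs j _ (hCp j ▸ mem_polyTrace.2 ⟨0, (hp j).pos, right_mem_segment ..⟩) hs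
        exact (hp j).ne 0 (hp j).pos ((hpx j).trans this.symm)
      · simp only [mem_iUnion, exists_prop] at hz
        obtain ⟨i, ⟨h1, h2⟩, hz⟩ := hz
        exact hnot i h1 h2 (hCs j z (hCp j ▸ mem_polyTrace.2 ⟨i, h2, hz⟩) hs ▸ hz)
  obtain ⟨ε, hε, hKε⟩ := exists_lt_excess hK hKs
  have hP1 : ∀ j, ε < excess c x (p j 1) := fun j =>
    hKε _ (Or.inr (mem_iUnion.2 ⟨j, Or.inl rfl⟩))
  have hPt : ∀ j i, 1 ≤ i → i < n j → ∀ z ∈ segment ℝ (p j i) (p j (i + 1)), ε < excess c x z :=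
    fun j i h1 h2 z hz => hKε _ (Or.inr (mem_iUnion.2 ⟨j, Or.inr (mem_biUnion ⟨h1, h2⟩ hz)⟩))
  choose q hq hqε C' hC' hCq using fun j => (hp j).exists_reroute (c := c) hε
    (by rw [hpx]; exact hP1 j) (by rw [hpx]; exact hPt j)
  simp only [hpx, hpy, ← hCp] at hq hqε hC' hCq
  have hxq : ∀ j, q j ≠ x := fun j h => by
    have := hqε j
    rw [h, excess_right] at this
    exact hε.ne this
  have hyε : ∀ j, ε < excess c x (y j) := by
    intro j
    rw [← hpy]
    rcases (Nat.succ_le_of_lt (hp j).pos).lt_or_eq with h | h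
    · refine hPt j (n j - 1) (by omega) (by omega) _ ?_
      rw [Nat.sub_add_cancel (by omega)]
      exact right_mem_segment ..
    · rw [← h]
      exact hP1 j
  refine ⟨C', hC', fun i j hij z hi hj => ?_, fun j z hj hzF => ?_⟩
  · rcases hCq i z hi with ⟨hi1, hi2⟩ | ⟨hi1, hi2⟩ <;>
      rcases hCq j z hj with ⟨hj1, hj2⟩ | ⟨hj1, hj2⟩
    · -- Inside the ellipse: different exit points lie on different rays from `c`.
      by_contra hzc
      have hne : q i ≠ q j := fun h => hxq i (hCC i j hij _ (hq i) (h ▸ hq j))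
      rcases mem_segment_or_mem_segment hi2 hj2 hzc with h | h
      · exact (excess_lt_of_mem hε (hqε j) h hne).ne (hqε i)
      · exact (excess_lt_of_mem hε (hqε i) h hne.symm).ne (hqε j)
    · exact absurd hi1 hj1.not_gt
    · exact absurd hj1 hi1.not_gt
    · have := hCC i j hij z hi2 hj2
      rw [this, excess_right] at hi1
      exact absurd hi1 hε.not_ge
  · rcases hCq j z hj with ⟨h1, h2⟩ | ⟨h1, h2⟩
    · left
      rcases hzF with hz | hz
      · exact absurd (hKε z (Or.inl (Or.inl hz))) h1.not_gt
      · simp only [mem_iUnion, exists_prop] at hz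
        obtain ⟨d, hd, hzd⟩ := hz
        by_contra hzc
        have hdc : d ≠ c := by
          rintro rfl
          rw [segment_same] at hzd
          exact hzc hzd
        -- Either the exit point would be on `F`, or `d` would be inside the ellipse.
        rcases mem_segment_or_mem_segment h2 hzd hzc with h | h
        · have := hCF j _ (hq j) (Or.inr (mem_biUnion hd h))
          have h3 := hyε j
          rw [← this, hqε] at h3
          exact lt_irrefl _ h3
        · exact (excess_le_of_mem hε (hqε j) h).not_gt (hKε d (Or.inl (Or.inr ⟨hd, hdc⟩)))
    · exact Or.inr (hCF j z h2 hzF)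

/-- Finitely many arcs from the end of a polygonal path can be led to its start, without new
intersections among them or with the fixed set `F`. -/
theorem exists_reroute_path {M : Type*} [Finite M] {n : ℕ} {p : ℕ → Plane} (hp : IsPolyPath n p)
    {F : Set Plane} (hF : IsConicAt (p 0) F) (hFs : ∀ z ∈ F, z ∈ polyTrace n p → z = p 0)
    {C : M → Set Plane} {y : M → Plane} (hC : ∀ j, IsPolygonalArc (p n) (y j) (C j))
    (hCs : ∀ j, ∀ z ∈ C j, z ∈ polyTrace n p → z = p n)
    (hCC : ∀ i j, i ≠ j → ∀ z ∈ C i, z ∈ C j → z = p n)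
    (hCF : ∀ j, ∀ z ∈ C j, z ∈ F → z = y j) :
    ∃ C' : M → Set Plane, (∀ j, IsPolygonalArc (p 0) (y j) (C' j)) ∧
      (∀ i j, i ≠ j → ∀ z ∈ C' i, z ∈ C' j → z = p 0) ∧
      ∀ j, ∀ z ∈ C' j, z ∈ F → z = p 0 ∨ z = y j := by
  obtain ⟨m, rfl⟩ : ∃ m, n = m + 1 := ⟨n - 1, by have := hp.pos; omega⟩
  induction m generalizing C with
  | zero =>
    have hs : ∀ z ∈ segment ℝ (p 0) (p 1), z ∈ polyTrace 1 p := fun z hz =>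
      mem_polyTrace.2 ⟨0, one_pos, hz⟩
    exact exists_reroute_segment hF (fun z hz h => hFs z hz (hs z h)) hC
      (fun j z hz h => hCs j z hz (hs z h)) hCC hCF
  | succ m ih =>
    -- The arcs are first led back over the last segment; the rest of the path is kept fixed.
    have hmono : polyTrace (m + 1) p ⊆ polyTrace (m + 2) p := by
      intro z hz
      obtain ⟨i, hi, hz⟩ := mem_polyTrace.1 hz
      exact mem_polyTrace.2 ⟨i, by omega, hz⟩
    have hlast : segment ℝ (p (m + 1)) (p (m + 2)) ⊆ polyTrace (m + 2) p := fun z hz =>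
      mem_polyTrace.2 ⟨m + 1, by omega, hz⟩
    have hend : p (m + 2) ∉ polyTrace (m + 1) p := by
      intro hz
      obtain ⟨i, hi, hz⟩ := mem_polyTrace.1 hz
      rcases hp.eq_or_eq_of_mem le_rfl (by omega) hz with h | h <;> omega
    have hF1 : p (m + 1) ∉ F := by
      intro h
      have := hFs _ h (hlast (left_mem_segment ..))
      have := hp.injOn (by omega) (by omega) this
      omega
    have hconic : IsConicAt (p (m + 1)) (F ∪ polyTrace (m + 1) p) := by
      refine ⟨F ∪ polyTrace m p, {p m}, hF.isCompact.union (isCompact_polyTrace _ _), ?_,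
        Set.finite_singleton _, ?_⟩
      · rintro (h | h)
        · exact hF1 h
        · obtain ⟨i, hi, hz⟩ := mem_polyTrace.1 h
          rcases hp.eq_or_eq_of_mem (by omega) (by omega) hz with h | h <;> omega
      · rw [biUnion_singleton, union_assoc, segment_symm]
        congr 1
        ext z
        simp only [mem_union, mem_polyTrace]
        constructor
        · rintro ⟨i, hi, hz⟩
          rcases (Nat.lt_succ_iff.1 hi).lt_or_eq with h | rfl
          · exact Or.inl ⟨i, h, hz⟩
          · exact Or.inr hz
        · rintro (⟨i, hi, hz⟩ | hz)
          · exact ⟨i, by omega, hz⟩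
          · exact ⟨m, by omega, hz⟩
    have hfix : ∀ z ∈ F ∪ polyTrace (m + 1) p, z ∈ segment ℝ (p (m + 1)) (p (m + 2)) →
        z = p (m + 1) := by
      rintro z (hz | hz) hs
      · have h0 := hFs z hz (hlast hs)
        rcases hp.eq_or_eq_of_mem (Nat.zero_le _) (by omega) (h0 ▸ hs) with h | h <;> omega
      · obtain ⟨i, hi, hz⟩ := mem_polyTrace.1 hz
        obtain ⟨h4, h5⟩ := hp.eq_of_mem_of_mem hi (by omega) hz hs
        rw [h5, h4]
    have hmeet : ∀ j, ∀ z ∈ C j, z ∈ F ∪ polyTrace (m + 1) p → z = y j := by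
      rintro j z hz (h | h)
      · exact hCF j z hz h
      · exact absurd (hCs j z hz (hmono h) ▸ h) hend
    obtain ⟨C', h1, h2, h3⟩ := exists_reroute_segment hconic hfix hC
      (fun j z hz h => hCs j z hz (hlast h)) hCC hmeet
    refine ih ?_ ⟨by omega, fun i hi => hp.ne i (by omega), fun i hi => hp.inter i (by omega),
      fun i j hij hj => hp.disj i j hij (by omega)⟩ (fun z hz h => hFs z hz (hmono h)) h1
      ?_ h2
    · intro j z hz h
      rcases h3 j z hz (Or.inl h) with rfl | h4
      · exact absurd h hF1
      · exact h4
    · intro j z hz h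
      rcases h3 j z hz (Or.inr h) with h4 | rfl
      · exact h4
      · obtain ⟨n', p', hp', -, hy', hC'⟩ := isPolygonalArc_iff.1 (hC j)
        have hyC : y j ∈ C j := by
          rw [hC', ← hy']
          refine mem_polyTrace.2 ⟨n' - 1, by have := hp'.pos; omega, ?_⟩
          rw [Nat.sub_add_cancel hp'.pos]
          exact right_mem_segment ..
        exact absurd (hCs j _ hyC (hmono h) ▸ h) hend

/-! ### Contraction of an edge -/

lemma IsPolyPath.reverse {n : ℕ} {p : ℕ → Plane} (h : IsPolyPath n p) :
    IsPolyPath n fun i => p (n - i) := by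
  have hseg : ∀ i, i < n → segment ℝ (p (n - i)) (p (n - (i + 1))) =
      segment ℝ (p (n - (i + 1))) (p (n - (i + 1) + 1)) := by
    intro i hi
    rw [segment_symm, show n - (i + 1) + 1 = n - i by omega]
  refine ⟨h.pos, fun i hi => ?_, fun i hi => ?_, fun i j hij hj => ?_⟩
  · have := h.ne (n - (i + 1)) (by omega)
    rw [show n - (i + 1) + 1 = n - i by omega] at this
    exact this.symm
  · have := h.inter (n - (i + 2)) (by omega)
    beta_reduce
    rw [hseg i (by omega), hseg (i + 1) hi, inter_comm,
      show n - (i + 1) = n - (i + 2) + 1 by omega]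
    exact this
  · beta_reduce
    rw [hseg i (by omega), hseg j hj]
    exact (h.disj _ _ (by omega) (by omega)).symm

lemma IsPolygonalArc.symm {x y : Plane} {C : Set Plane} (h : IsPolygonalArc x y C) :
    IsPolygonalArc y x C := by
  obtain ⟨n, p, hp, rfl, rfl, rfl⟩ := isPolygonalArc_iff.1 h
  refine isPolygonalArc_iff.2 ⟨n, _, hp.reverse, by simp, by simp, ?_⟩
  ext z
  simp only [mem_polyTrace]
  constructor
  · rintro ⟨i, hi, hz⟩
    refine ⟨n - (i + 1), by omega, ?_⟩
    rwa [segment_symm, show n - (n - (i + 1) + 1) = i by omega,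
      show n - (n - (i + 1)) = i + 1 by omega]
  · rintro ⟨i, hi, hz⟩
    refine ⟨n - (i + 1), by omega, ?_⟩
    rwa [segment_symm, show n - (i + 1) + 1 = n - i by omega]

lemma IsPolyPath.isConicAt {n : ℕ} {p : ℕ → Plane} (h : IsPolyPath n p) :
    IsConicAt (p 0) (polyTrace n p) := by
  refine ⟨⋃ i ∈ {i | 1 ≤ i ∧ i < n}, segment ℝ (p i) (p (i + 1)), {p 1}, ?_, ?_,
    Set.finite_singleton _, ?_⟩
  · exact ((Set.finite_Iio n).subset fun i hi => hi.2).isCompact_biUnion fun _ _ =>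
      Plane.isCompact_segment _ _
  · simp only [mem_iUnion, not_exists]
    rintro i ⟨h1, h2⟩ hz
    rcases h.eq_or_eq_of_mem (Nat.zero_le _) h2 hz with h | h <;> omega
  · ext z
    simp only [mem_polyTrace, mem_union, mem_iUnion, exists_prop, mem_singleton_iff,
      exists_eq_left]
    constructor
    · rintro ⟨i, hi, hz⟩
      rcases Nat.eq_zero_or_pos i with rfl | h0
      · exact Or.inr hz
      · exact Or.inl ⟨i, ⟨h0, hi⟩, hz⟩
    · rintro (⟨i, ⟨-, hi⟩, hz⟩ | hz)
      · exact ⟨i, hi, hz⟩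
      · exact ⟨0, h.pos, hz⟩

lemma IsConicAt.of_notMem {c : Plane} {F : Set Plane} (hF : IsCompact F) (hc : c ∉ F) :
    IsConicAt c F :=
  ⟨F, ∅, hF, hc, Set.finite_empty, by simp⟩

lemma IsConicAt.singleton (c x : Plane) : IsConicAt c {x} := by
  by_cases h : c = x
  · exact ⟨∅, {c}, isCompact_empty, by simp, Set.finite_singleton _, by simp [h]⟩
  · exact .of_notMem isCompact_singleton h

lemma IsConicAt.union {c : Plane} {F F' : Set Plane} (h : IsConicAt c F) (h' : IsConicAt c F') :
    IsConicAt c (F ∪ F') := by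
  obtain ⟨F₀, D, h1, h2, h3, rfl⟩ := h
  obtain ⟨F₀', D', h1', h2', h3', rfl⟩ := h'
  refine ⟨F₀ ∪ F₀', D ∪ D', h1.union h1', by simp [h2, h2'], h3.union h3', ?_⟩
  rw [biUnion_union, union_union_union_comm]

lemma IsConicAt.iUnion {ι : Type*} [Finite ι] {c : Plane} {F : ι → Set Plane}
    (h : ∀ i, IsConicAt c (F i)) : IsConicAt c (⋃ i, F i) := by
  choose F₀ D h1 h2 h3 h4 using h
  refine ⟨⋃ i, F₀ i, ⋃ i, D i, isCompact_iUnion h1, by simpa using h2, Set.finite_iUnion h3, ?_⟩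
  rw [biUnion_iUnion, ← iUnion_union_distrib]
  exact iUnion_congr h4

namespace SimpleGraph

variable {V : Type u} {G : SimpleGraph V}

/-- Near the point of any vertex, an arc of a drawing is a single segment or absent. -/
lemma PlaneDrawing.isConicAt_curve (D : G.PlaneDrawing) {e : Sym2 V} (he : e ∈ G.edgeSet) (u : V) :
    IsConicAt (D.pos u) (D.curve e) := by
  by_cases hu : u ∈ e
  · obtain ⟨w, rfl⟩ := Sym2.mem_iff_exists.1 hu
    obtain ⟨n, p, hp, h1, -, h2⟩ := isPolygonalArc_iff.1 (D.isPolygonalArc u w he)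
    rw [h2, ← h1]
    exact hp.isConicAt
  · induction e using Sym2.ind with
    | _ x y =>
      obtain ⟨n, p, hp, -, -, h2⟩ := isPolygonalArc_iff.1 (D.isPolygonalArc x y he)
      exact .of_notMem (h2 ▸ isCompact_polyTrace _ _) fun h => hu (D.mem_of_pos_mem _ he u h)

/-- The graph that results from `G` when `v` is contracted into `u`: the vertex `v` disappears, and
its neighbours become neighbours of `u`. -/
def contract (G : SimpleGraph V) (u v : V) : SimpleGraph {x // x ≠ v} where
  Adj x y := x ≠ y ∧ (G.Adj x y ∨ (x.1 = u ∧ G.Adj v y) ∨ (y.1 = u ∧ G.Adj v x))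
  symm := ⟨fun x y h => ⟨h.1.symm, by
    rcases h.2 with h | h | h
    · exact Or.inl h.symm
    · exact Or.inr (Or.inr h)
    · exact Or.inr (Or.inl h)⟩⟩
  loopless := ⟨fun _ h => h.1 rfl⟩

theorem IsPlanar.contract [Finite V] (hG : G.IsPlanar) {u v : V} (huv : G.Adj u v) :
    (G.contract u v).IsPlanar := by
  classical
  obtain ⟨D⟩ := hG
  obtain ⟨n, p, hp, hp0, hpn, hpt⟩ := isPolygonalArc_iff.1 (D.isPolygonalArc u v huv)
  let M := {y : V // G.Adj v y ∧ y ≠ u}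
  -- Everything that stays in place: the edges that avoid `v`, and the vertices.
  let F : Set Plane := (⋃ e : {e : Sym2 V // e ∈ G.edgeSet ∧ v ∉ e}, D.curve e) ∪
    ⋃ w : {w : V // w ≠ v}, {D.pos w}
  have hFe : ∀ e ∈ G.edgeSet, v ∉ e → D.curve e ⊆ F := fun e he hv z hz =>
    Or.inl (mem_iUnion.2 ⟨⟨e, he, hv⟩, hz⟩)
  have hFw : ∀ w, w ≠ v → D.pos w ∈ F := fun w hw => Or.inr (mem_iUnion.2 ⟨⟨w, hw⟩, rfl⟩)
  have hFc : IsConicAt (p 0) F := by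
    rw [hp0]
    exact (IsConicAt.iUnion fun e => D.isConicAt_curve e.2.1 u).union
      (IsConicAt.iUnion fun _ => .singleton _ _)
  have hF : ∀ x ≠ v, ∀ e ∈ G.edgeSet, e = s(v, x) → ∀ z ∈ F, z ∈ D.curve e → z = D.pos x := by
    rintro x hx e he rfl z (hz | hz) hze
    · obtain ⟨⟨f, hf, hvf⟩, hz⟩ := mem_iUnion.1 hz
      obtain ⟨w, h1, h2, rfl⟩ := D.eq_pos_of_mem _ he f hf (fun h => hvf (by simp [← h])) z
        ⟨hze, hz⟩
      rcases Sym2.mem_iff.1 h1 with rfl | rfl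
      · exact absurd h2 hvf
      · rfl
    · obtain ⟨⟨w, hw⟩, rfl⟩ := mem_iUnion.1 hz
      rcases Sym2.mem_iff.1 (D.mem_of_pos_mem _ he w hze) with h | h
      · exact absurd h hw
      · exact congrArg D.pos h
  have hcommon : ∀ x y, x ≠ y → G.Adj v x → G.Adj v y →
      ∀ z ∈ D.curve s(v, x), z ∈ D.curve s(v, y) → z = D.pos v := by
    intro x y hxy hx hy z hzx hzy
    obtain ⟨w, h1, h2, rfl⟩ := D.eq_pos_of_mem _ hx _ hy
      (fun h => hxy (Sym2.congr_right.1 h)) z ⟨hzx, hzy⟩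
    rcases Sym2.mem_iff.1 h1 with rfl | rfl
    · rfl
    · rcases Sym2.mem_iff.1 h2 with rfl | rfl
      · rfl
      · exact absurd rfl hxy
  obtain ⟨C, hC, hCC, hCF⟩ := exists_reroute_path (M := M) hp hFc
    (fun z hz h => by
      rw [hp0]
      exact hF u huv.ne _ huv.symm rfl z hz (by rw [Sym2.eq_swap, hpt]; exact h))
    (C := fun j => D.curve s(v, j.1)) (y := fun j => D.pos j.1)
    (fun j => by rw [hpn]; exact D.isPolygonalArc v j.1 j.2.1)
    (fun j z hz h => by
      rw [hpn]
      refine hcommon j.1 u j.2.2 j.2.1 huv.symm z hz ?_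
      rw [Sym2.eq_swap, hpt]
      exact h)
    (fun i j hij z hi hj => by
      rw [hpn]
      exact hcommon i.1 j.1 (fun h => hij (Subtype.ext h)) i.2.1 j.2.1 z hi hj)
    (fun j z hz h => hF j.1 j.2.1.ne' _ j.2.1 rfl z h hz)
  rw [hp0] at hC hCC hCF
  let ι : {x // x ≠ v} → V := Subtype.val
  have hι : Function.Injective ι := Subtype.val_injective
  -- An edge of the contracted graph keeps its arc if it comes from an edge of `G`, and otherwise
  -- receives the moved arc; the union is over the only possible index.
  let curve' : Sym2 {x // x ≠ v} → Set Plane := fun e =>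
    if e.map ι ∈ G.edgeSet then D.curve (e.map ι) else ⋃ j : {j : M // e.map ι = s(u, j.1)}, C j.1
  have hmem : ∀ (e : Sym2 {x // x ≠ v}) (w : {x // x ≠ v}), w.1 ∈ e.map ι → w ∈ e := by
    intro e w hw
    obtain ⟨w', h1, h2⟩ := Sym2.mem_map.1 hw
    exact hι h2 ▸ h1
  have hv : ∀ e : Sym2 {x // x ≠ v}, v ∉ e.map ι := by
    intro e he
    obtain ⟨w, -, h2⟩ := Sym2.mem_map.1 he
    exact w.2 h2
  have hcase : ∀ e ∈ (G.contract u v).edgeSet,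
      (e.map ι ∈ G.edgeSet ∧ curve' e = D.curve (e.map ι)) ∨
        ∃ j : M, e.map ι = s(u, j.1) ∧ curve' e = C j := by
    intro e he
    by_cases h : e.map ι ∈ G.edgeSet
    · exact Or.inl ⟨h, if_pos h⟩
    · right
      obtain ⟨j, hj⟩ : ∃ j : M, e.map ι = s(u, j.1) := by
        induction e using Sym2.ind with
        | _ x y =>
          obtain ⟨hxy, h1 | ⟨h1, h2⟩ | ⟨h1, h2⟩⟩ := he
          · exact absurd h1 h
          · exact ⟨⟨y.1, h2, fun h3 => hxy (hι (h1.trans h3.symm))⟩,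
              Sym2.eq_iff.2 (Or.inl ⟨h1, rfl⟩)⟩
          · exact ⟨⟨x.1, h2, fun h3 => hxy (hι (h3.trans h1.symm))⟩,
              Sym2.eq_iff.2 (Or.inr ⟨rfl, h1⟩)⟩
      refine ⟨j, hj, ?_⟩
      have huniq : ∀ i : {i : M // e.map ι = s(u, i.1)}, i.1 = j := fun i =>
        Subtype.ext (Sym2.congr_right.1 (i.2.symm.trans hj))
      simp only [curve', if_neg h]
      ext z
      simp only [mem_iUnion]
      exact ⟨fun ⟨i, hi⟩ => huniq i ▸ hi, fun hz => ⟨⟨j, hj⟩, hz⟩⟩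
  refine ⟨⟨fun x => D.pos x.1, curve', D.pos_injective.comp hι, fun a b hab => ?_, ?_, ?_⟩⟩
  · rcases hcase s(a, b) hab with ⟨h1, h2⟩ | ⟨j, h1, h2⟩ <;> rw [h2]
    · exact D.isPolygonalArc a.1 b.1 h1
    · rcases Sym2.eq_iff.1 h1 with ⟨h3, h4⟩ | ⟨h3, h4⟩
      · rw [show a.1 = u from h3, show b.1 = j.1 from h4]
        exact hC j
      · rw [show a.1 = j.1 from h3, show b.1 = u from h4]
        exact (hC j).symm
  · intro e he w hw
    apply hmem
    rcases hcase e he with ⟨h1, h2⟩ | ⟨j, h1, h2⟩ <;> rw [h2] at hw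
    · exact D.mem_of_pos_mem _ h1 w.1 hw
    · rw [h1, Sym2.mem_iff]
      exact (hCF j _ hw (hFw w.1 w.2)).imp (fun h => D.pos_injective h) fun h => D.pos_injective h
  · -- A moved edge meets an edge that stays in place only at a common end.
    have hmix : ∀ (e f : Sym2 {x // x ≠ v}) (j : M), f.map ι ∈ G.edgeSet → e.map ι = s(u, j.1) →
        ∀ z ∈ C j, z ∈ D.curve (f.map ι) → ∃ w, w ∈ e ∧ w ∈ f ∧ z = D.pos w.1 := by
      intro e f j hf he z hz hzf
      have key : ∀ w : V, w ≠ v → w ∈ e.map ι → z = D.pos w →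
          ∃ w, w ∈ e ∧ w ∈ f ∧ z = D.pos w.1 := by
        rintro w hw hwe rfl
        exact ⟨⟨w, hw⟩, hmem _ _ hwe, hmem _ _ (D.mem_of_pos_mem _ hf w hzf), rfl⟩
      rcases hCF j z hz (hFe _ hf (hv f) hzf) with h | h
      · exact key u huv.ne (by simp [he]) h
      · exact key j.1 j.2.1.ne' (by simp [he]) h
    rintro e he f hf hne z ⟨hze, hzf⟩
    rcases hcase e he with ⟨h1, h2⟩ | ⟨j, h1, h2⟩ <;>
      rcases hcase f hf with ⟨h3, h4⟩ | ⟨k, h3, h4⟩ <;> rw [h2] at hze <;> rw [h4] at hzf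
    · obtain ⟨w, h5, h6, h7⟩ := D.eq_pos_of_mem _ h1 _ h3
        (fun h => hne (Sym2.map.injective hι h)) z ⟨hze, hzf⟩
      exact ⟨⟨w, fun h => hv e (h ▸ h5)⟩, hmem _ _ h5, hmem _ _ h6, h7⟩
    · obtain ⟨w, h5, h6, h7⟩ := hmix f e k h1 h3 z hzf hze
      exact ⟨w, h6, h5, h7⟩
    · exact hmix e f j h3 h1 z hze hzf
    · have hjk : j ≠ k := fun h => hne (Sym2.map.injective hι (by rw [h1, h3, h]))
      exact ⟨⟨u, huv.ne⟩, hmem _ _ (by simp [h1]), hmem _ _ (by simp [h3]), hCC j k hjk z hze hzf⟩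

/-! ### Minors -/

/-- If the branch sets of a minor are not all singletons, a vertex of one of them can be contracted
into a neighbour in the same branch set. -/
lemma IsMinorOf.exists_contract [Finite V] {W : Type v} {H : SimpleGraph W} {branch : W → Set V}
    (hconn : ∀ w, (G.induce (branch w)).Connected)
    (hdisj : ∀ w w', w ≠ w' → Disjoint (branch w) (branch w'))
    (hadj : ∀ w w', H.Adj w w' → ∃ a ∈ branch w, ∃ b ∈ branch w', G.Adj a b)
    {w₀ : W} (hw₀ : (branch w₀).Nontrivial) :
    ∃ u v, G.Adj u v ∧ H.IsMinorOf (G.contract u v) := by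
  have : Nontrivial (branch w₀) := hw₀.coe_sort
  obtain ⟨⟨v, hv⟩, hvc⟩ :=
    (hconn w₀).exists_connected_induce_compl_singleton_of_finite_nontrivial
  obtain ⟨⟨u, hu⟩, huv'⟩ := (hconn w₀).preconnected.exists_adj_of_nontrivial ⟨v, hv⟩
  have huv : G.Adj v u := huv'
  have hbr : ∀ w, v ∈ branch w → w = w₀ := by
    intro w hw
    by_contra hne
    exact Set.disjoint_left.1 (hdisj w w₀ hne) hw hv
  refine ⟨u, v, huv.symm, fun w => {x | x.1 ∈ branch w}, fun w => ?_, fun w w' hne => ?_,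
    fun w w' h => ?_⟩
  · have hadj' : ∀ x y : {x // x ≠ v}, G.Adj x y → (G.contract u v).Adj x y := fun x y h =>
      ⟨fun hxy => h.ne (congrArg _ hxy), Or.inl h⟩
    by_cases hw : w = w₀
    · subst hw
      -- The branch set of `v` stays connected without `v`.
      refine hvc.map ⟨fun x => ⟨⟨x.1.1, fun h => x.2 (Subtype.ext h)⟩, x.1.2⟩,
        fun {x y} h => hadj' _ _ h⟩ ?_
      rintro ⟨⟨x, hx⟩, hxw⟩
      exact ⟨⟨⟨x, hxw⟩, fun h => hx (congrArg Subtype.val h)⟩, rfl⟩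
    · refine (hconn w).map ⟨fun x => ⟨⟨x.1, fun h => hw (hbr w (h ▸ x.2))⟩, x.2⟩,
        fun {x y} h => hadj' _ _ h⟩ ?_
      rintro ⟨⟨x, hx⟩, hxw⟩
      exact ⟨⟨x, hxw⟩, rfl⟩
  · exact Set.disjoint_left.2 fun x hx hx' => Set.disjoint_left.1 (hdisj w w' hne) hx hx'
  · obtain ⟨a, ha, b, hb, hab⟩ := hadj w w' h
    have hne : ∀ x ∈ branch w, ∀ y ∈ branch w', x ≠ y := by
      rintro x hx _ hy rfl
      exact Set.disjoint_left.1 (hdisj w w' h.ne) hx hy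
    by_cases hav : a = v
    · subst hav
      obtain rfl := hbr w ha
      exact ⟨⟨u, huv.ne'⟩, hu, ⟨b, hab.ne'⟩, hb,
        fun h => hne u hu b hb (congrArg Subtype.val h), Or.inr (Or.inl ⟨rfl, hab⟩)⟩
    by_cases hbv : b = v
    · subst hbv
      obtain rfl := hbr w' hb
      exact ⟨⟨a, hav⟩, ha, ⟨u, huv.ne'⟩, hu,
        fun h => hne a ha u hu (congrArg Subtype.val h), Or.inr (Or.inr ⟨rfl, hab.symm⟩)⟩
    · exact ⟨⟨a, hav⟩, ha, ⟨b, hbv⟩, hb, fun h => hab.ne (congrArg Subtype.val h), Or.inl hab⟩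

theorem IsPlanar.of_isMinorOf [Finite V] {W : Type v} {H : SimpleGraph W} (hG : G.IsPlanar)
    (hH : H.IsMinorOf G) : H.IsPlanar := by
  induction hn : Nat.card V using Nat.strong_induction_on generalizing V with
  | _ n ih =>
    obtain ⟨branch, hconn, hdisj, hadj⟩ := hH
    by_cases hsub : ∀ w, (branch w).Subsingleton
    · let f : ∀ w, branch w := fun w => Classical.choice (hconn w).nonempty
      refine hG.of_embedding (fun w => f w) (fun w w' h => ?_) fun w w' h => ?_
      · by_contra hne
        have h : (f w).1 = (f w').1 := h
        exact Set.disjoint_left.1 (hdisj w w' hne) (f w).2 (h ▸ (f w').2)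
      · obtain ⟨a, ha, b, hb, hab⟩ := hadj w w' h
        rwa [hsub w (f w).2 ha, hsub w' (f w').2 hb]
    · push Not at hsub
      obtain ⟨w₀, hw₀⟩ := hsub
      obtain ⟨u, v, huv, hmin⟩ := IsMinorOf.exists_contract hconn hdisj hadj hw₀
      refine ih (Nat.card {x // x ≠ v}) ?_ (hG.contract huv) hmin rfl
      rw [← hn]
      exact Finite.card_subtype_lt (x := v) (by simp)

end SimpleGraph

theorem proposition4 :
    (∀ (V : Type u) [Finite V] (G : SimpleGraph V), G.IsPlanar →
      ∀ B : Set V, B.Nonempty →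
        G.edgesBetween (G.threeAttached B) B < 6 * B.ncard) ∧
    SimpleGraph.IsNiceFamily (fun (V : Type u) (G : SimpleGraph V) => G.IsPlanar) := by
  refine ⟨fun V _ G hG B hB => hG.edgesBetween_lt hB,
    fun V W _ _ G H hG hH => hG.of_isMinorOf hH, 6, fun V _ G hG B => ?_⟩
  rcases B.eq_empty_or_nonempty with rfl | hB
  · simp [SimpleGraph.edgesBetween]
  · exact_mod_cast (hG.edgesBetween_lt hB).le
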